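/- Theorem. There are constants $c(K)>0$, for every real $K$, and $C_1(m,F_0,F_1,K)>0$, for every integer $m\ge 1$ and all real $F_0,F_1,K$, with the following property. Let $M$ be a compact complex manifold of complex dimension $m\ge 1$ with a smooth Kähler metric $g$, given in local holomorphic coordinates by $(g_{a\bar b})$ with inverse $(g^{a\bar b})$, and let $\Delta u=-g^{a\bar b}\,\partial_a\partial_{\bar b}u$ be its complex Laplacian (note the sign). Then the curvature of $g$ is bounded, that is, there is a real $K$ such that $|R(u,\bar u,v,\bar v)|\le K$ for all $g$-unit vectors $u,v$ of type $(1,0)$ at a common point, where $R$ is the curvature tensor of $g$; and the following holds for every such $K$ and all real $F_0,F_1$. Let $\varphi:M\to\mathbb R$ be of class $C^5$ and admissible, i.e. the Hermitian matrix $\tilde g_{a\bar b}=g_{a\bar b}+\partial_a\partial_{\bar b}\varphi$ is positive definite everywhere, and suppose that $\varphi$ solves the Calabi–Yau equation $$\frac{\det(\tilde g)}{\det(g)}=e^{f}$$ on $M$, where $f:M\to\mathbb R$ is of class $C^3$ with $f\le F_0$ and $\Delta f\le F_1$. Then, everywhere on $M$, $$m-C_1(m,F_0,F_1,K)\,e^{c(K)(\sup_M\varphi-\inf_M\varphi)}\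 \le\ \Delta\varphi\ <\ m .$$ -/

import Mathlib

open scoped Manifold ContDiff ComplexOrder

noncomputable section

namespace KahlerGeometry

/-- The model space `ℂ^m`. -/
abbrev Cn (m : ℕ) : Type := EuclideanSpace ℂ (Fin m)

/-- The Wirtinger derivative `∂u/∂z^a = (∂u/∂x^a - i ∂u/∂y^a) / 2`. -/
def dz {m : ℕ} (a : Fin m) (u : Cn m → ℂ) (z : Cn m) : ℂ :=
  (fderiv ℝ u z (EuclideanSpace.single a 1)
    - Complex.I * fderiv ℝ u z (EuclideanSpace.single a Complex.I)) / 2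

/-- The Wirtinger derivative `∂u/∂z̄^a = (∂u/∂x^a + i ∂u/∂y^a) / 2`. -/
def dzbar {m : ℕ} (a : Fin m) (u : Cn m → ℂ) (z : Cn m) : ℂ :=
  (fderiv ℝ u z (EuclideanSpace.single a 1)
    + Complex.I * fderiv ℝ u z (EuclideanSpace.single a Complex.I)) / 2

/-- The complex Hessian `(∂²u/∂z^a∂z̄^b)_{a,b}`. -/
def complexHessian {m : ℕ} (u : Cn m → ℂ) (z : Cn m) : Matrix (Fin m) (Fin m) ℂ :=
  Matrix.of fun a b => dz a (dzbar b u) z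

/-- A Kähler metric on a complex manifold `M` of dimension `m`, given by its components
`g_{a b̄}` in the charts of the holomorphic atlas (the values of `coeff` at other charts or outside
the target of a chart play no role): smooth, Hermitian and positive definite, transforming as a
tensor of type `(1,1)` under holomorphic changes of coordinates, and with closed Kähler form
`i ∑ g_{a b̄} dz^a ∧ dz̄^b`. -/
structure KahlerMetric (m : ℕ) (M : Type*) [TopologicalSpace M] [ChartedSpace (Cn m) M] where
  /-- `coeff e z a b` is the component `g_{a b̄}` in the chart `e` at the point `z ∈ e.target`. -/
  coeff : OpenPartialHomeomorph M (Cn m) → Cn m → Matrix (Fin m) (Fin m) ℂ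
  posDef : ∀ e ∈ atlas (Cn m) M, ∀ z ∈ e.target, (coeff e z).PosDef
  smooth : ∀ e ∈ atlas (Cn m) M, ∀ a b : Fin m,
    ContDiffOn ℝ ∞ (fun z => coeff e z a b) e.target
  transform : ∀ e ∈ atlas (Cn m) M, ∀ e' ∈ atlas (Cn m) M, ∀ z ∈ (e.symm.trans e').source,
    ∀ a b : Fin m, coeff e z a b =
      ∑ c : Fin m, ∑ d : Fin m,
        fderiv ℂ (e.symm.trans e') z (EuclideanSpace.single a 1) c
          * (starRingEnd ℂ) (fderiv ℂ (e.symm.trans e') z (EuclideanSpace.single b 1) d)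
          * coeff e' (e.symm.trans e' z) c d
  closed : ∀ e ∈ atlas (Cn m) M, ∀ z ∈ e.target, ∀ a b c : Fin m,
    dz c (fun w => coeff e w a b) z = dz a (fun w => coeff e w c b) z

namespace KahlerMetric

variable {m : ℕ} {M : Type*} [TopologicalSpace M] [ChartedSpace (Cn m) M]

/-- The expression of a real function on `M` in the chart `e`, as a complex-valued function. -/
def localRep (φ : M → ℝ) (e : OpenPartialHomeomorph M (Cn m)) (z : Cn m) : ℂ :=
  ((φ (e.symm z) : ℝ) : ℂ)

/-- The components of `g̃ = g + ∂∂̄φ` in the chart `e`: `g̃_{a b̄} = g_{a b̄} + ∂²φ/∂z^a∂z̄^b`. -/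
def perturbed (g : KahlerMetric m M) (φ : M → ℝ) (e : OpenPartialHomeomorph M (Cn m))
    (z : Cn m) : Matrix (Fin m) (Fin m) ℂ :=
  g.coeff e z + complexHessian (localRep φ e) z

/-- `φ` is admissible if `g̃ = g + ∂∂̄φ` is positive definite. -/
def Admissible (g : KahlerMetric m M) (φ : M → ℝ) : Prop :=
  ∀ e ∈ atlas (Cn m) M, ∀ z ∈ e.target, (g.perturbed φ e z).PosDef

/-- The complex Laplacian with the sign `Δφ = - g^{a b̄} ∂²φ/∂z^a∂z̄^b = - tr (g⁻¹ ∂∂̄φ)`. The trace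
is real and the same in every chart; it is evaluated in the preferred chart at `x`. -/
def laplacian (g : KahlerMetric m M) (φ : M → ℝ) (x : M) : ℝ :=
  -(((g.coeff (chartAt (Cn m) x) (chartAt (Cn m) x x))⁻¹
      * complexHessian (localRep φ (chartAt (Cn m) x)) (chartAt (Cn m) x x)).trace).re

/-- The Calabi–Yau operator `YC(φ) = det g̃ / det g`. The ratio is the same in every chart; it is
evaluated in the preferred chart at `x`. -/
def calabiYau (g : KahlerMetric m M) (φ : M → ℝ) (x : M) : ℂ :=
  (g.perturbed φ (chartAt (Cn m) x) (chartAt (Cn m) x x)).det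
    / (g.coeff (chartAt (Cn m) x) (chartAt (Cn m) x x)).det

/-- The Hermitian product `g(u, v̄) = ∑ g_{a b̄} u^a v̄^b` of the tangent vectors `∑ u^a ∂/∂z^a` and
`∑ v^b ∂/∂z^b` at the point with coordinates `z` in the chart `e`. -/
def inner (g : KahlerMetric m M) (e : OpenPartialHomeomorph M (Cn m)) (z : Cn m)
    (u v : Fin m → ℂ) : ℂ :=
  ∑ a : Fin m, ∑ b : Fin m, g.coeff e z a b * u a * (starRingEnd ℂ) (v b)

/-- The components of the curvature tensor in the chart `e`:
`R_{a b̄ c d̄} = - ∂²g_{c d̄}/∂z^a∂z̄^b + ∑_{p,q} g^{p q̄} (∂g_{c q̄}/∂z^a) (∂g_{p d̄}/∂z̄^b)`,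
where `g^{p q̄}` is the `(q, p)` entry of the inverse matrix. -/
def curvature (g : KahlerMetric m M) (e : OpenPartialHomeomorph M (Cn m)) (z : Cn m)
    (a b c d : Fin m) : ℂ :=
  -(dz a (dzbar b fun w => g.coeff e w c d) z)
    + ∑ p : Fin m, ∑ q : Fin m,
        (g.coeff e z)⁻¹ q p * dz a (fun w => g.coeff e w c q) z
          * dzbar b (fun w => g.coeff e w p d) z

/-- The bisectional curvature form `R(u, ū, v, v̄)`. -/
def bisectional (g : KahlerMetric m M) (e : OpenPartialHomeomorph M (Cn m)) (z : Cn m)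
    (u v : Fin m → ℂ) : ℂ :=
  ∑ a : Fin m, ∑ b : Fin m, ∑ c : Fin m, ∑ d : Fin m,
    g.curvature e z a b c d * u a * (starRingEnd ℂ) (u b) * v c * (starRingEnd ℂ) (v d)

/-- The curvature of `g` is bounded by `K`: `|R(u, ū, v, v̄)| ≤ K` for all `g`-unit vectors `u`, `v`
of type `(1,0)` at the same point. -/
def CurvatureBoundedBy (g : KahlerMetric m M) (K : ℝ) : Prop :=
  ∀ e ∈ atlas (Cn m) M, ∀ z ∈ e.target, ∀ u v : Fin m → ℂ,
    g.inner e z u u = 1 → g.inner e z v v = 1 → ‖g.bisectional e z u v‖ ≤ K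

end KahlerMetric

end KahlerGeometry

end

/-!
The estimate is the second order estimate of Aubin and Yau. Write `S = tr(g⁻¹g̃) = m - Δφ`, the sum
of the eigenvalues `λ_i > 0` of `g̃` with respect to `g`. Positivity of `S` is the upper bound
`Δφ < m`, and the lower bound amounts to an upper bound of `S`, which the maximum principle for
`S e^{-cφ}` provides, with `c = 2|K| + 1`.

The computation is carried out at a point of an arbitrary holomorphic chart, with matrices of
functions and the curvature `R_v = -∂_v∂_v̄ G + ∂_v G · G⁻¹ · ∂_v̄ G` of the Chern connection
(`chernCurv`), so that no normal coordinates are needed. The complex Hessian of `S` is the sum of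
the curvature of `g`, minus the Ricci type trace of the curvature of `g̃`, and a nonnegative term
quadratic in the covariant derivative of `g̃` (`wd_wd_trace_inv_mul`). At a maximum of `S e^{-cφ}`
the quadratic term absorbs the square of the gradient of `log S` by the Cauchy–Schwarz inequality
(`norm_trace_sq_le`, `direction_le_of_isLocalMax`). Summing over a basis orthonormal for `g` and
orthogonal for `g̃`, with the weights `λ_i⁻¹`, the symmetry of the Kähler curvature tensor
(`IsKahlerNear.bisect_symm`) turns the curvature of `g̃` into its Ricci form, which the equation
`det g̃ = e^f det g`, differentiated twice (`wd_wd_of_det_eq`), expresses by `f` and `g`. The result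
is a bound of `∑ λ_i⁻¹` at the maximum, unless `S ≤ 1` there (`sum_inv_le_of_isLocalMax`). Since
`∏ λ_i = e^f ≤ e^{F₀}`, this bounds `S` at the maximum, hence `S` everywhere up to the factor
`e^{c (sup φ - inf φ)}`.

To globalize, the Laplacian, the ratio of determinants and the curvature are shown not to depend on
the chart (`KahlerMetric.laplacian_eq`, `KahlerMetric.calabiYau_eq`, `bisect_comp`). The last of
these also yields the boundedness of the curvature: in one chart it is bounded near each point by a
continuous function (`norm_bisect_le`), and the bound carries over to the other charts.
-/

namespace KahlerGeometry

/-! ### Wirtinger derivatives -/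

section Wirtinger

variable {E : Type*} [NormedAddCommGroup E] [NormedSpace ℂ E]

/-- The part of type `(1,0)` (for `s = -1`), respectively `(0,1)` (for `s = 1`), of the derivative
of `u` in the direction `v`. In coordinates these are the Wirtinger derivatives. The sign is a
parameter so that the rules common to both types are proved once. -/
noncomputable def wd (s : ℂ) (v : E) (u : E → ℂ) (z : E) : ℂ :=
  (fderiv ℝ u z v + s * Complex.I * fderiv ℝ u z (Complex.I • v)) / 2

variable {s t : ℂ} {v v' : E} {u u' : E → ℂ} {z : E}

theorem wd_congr (h : u =ᶠ[nhds z] u') : wd s v u z = wd s v u' z := by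
  simp only [wd, h.fderiv_eq]

theorem wd_eventuallyEq (h : u =ᶠ[nhds z] u') : wd s v u =ᶠ[nhds z] wd s v u' :=
  h.eventuallyEq_nhds.mono fun _ hw => wd_congr hw

theorem wd_const (c : ℂ) : wd s v (fun _ => c) z = 0 := by
  simp [wd]

theorem wd_add (h : DifferentiableAt ℝ u z) (h' : DifferentiableAt ℝ u' z) :
    wd s v (fun w => u w + u' w) z = wd s v u z + wd s v u' z := by
  simp only [wd, fderiv_fun_add h h', add_apply]
  ring

theorem wd_sub (h : DifferentiableAt ℝ u z) (h' : DifferentiableAt ℝ u' z) :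
    wd s v (fun w => u w - u' w) z = wd s v u z - wd s v u' z := by
  simp only [wd, fderiv_fun_sub h h', sub_apply]
  ring

theorem wd_mul (h : DifferentiableAt ℝ u z) (h' : DifferentiableAt ℝ u' z) :
    wd s v (fun w => u w * u' w) z = wd s v u z * u' z + u z * wd s v u' z := by
  simp only [wd, fderiv_fun_mul h h', add_apply,
    smul_apply, smul_eq_mul]
  ring

theorem wd_sum {ι : Type*} (S : Finset ι) {U : ι → E → ℂ}
    (h : ∀ i ∈ S, DifferentiableAt ℝ (U i) z) :
    wd s v (fun w => ∑ i ∈ S, U i w) z = ∑ i ∈ S, wd s v (U i) z := by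
  simp only [wd, fderiv_fun_sum h, sum_apply, Finset.mul_sum,
    ← Finset.sum_add_distrib, Finset.sum_div]

theorem wd_vec_add : wd s (v + v') u z = wd s v u z + wd s v' u z := by
  simp only [wd, smul_add, map_add]
  ring

theorem wd_vec_smul_I (hs : s * s = 1) :
    wd s (Complex.I • v) u z = -(s * Complex.I) * wd s v u z := by
  have h : (Complex.I • Complex.I • v) = -v := by
    rw [smul_smul, Complex.I_mul_I, neg_one_smul]
  simp only [wd, h, map_neg]
  have : s * Complex.I * (s * Complex.I) = -1 := by
    rw [mul_mul_mul_comm, hs, Complex.I_mul_I]; ring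
  linear_combination (1 / 2 * fderiv ℝ u z (Complex.I • v)) * this

theorem wd_vec_smul_real (r : ℝ) : wd s ((r : ℂ) • v) u z = r * wd s v u z := by
  have h1 : ((r : ℂ) • v) = r • v := Complex.coe_smul r v
  have h2 : Complex.I • (r : ℂ) • v = r • Complex.I • v := by
    rw [smul_comm, Complex.coe_smul]
  rw [wd, wd, h2, h1]
  simp only [map_smul, Complex.real_smul]
  ring

/-- The `(1,0)` derivative is complex linear in the direction. -/
theorem wd_vec_smul (c : ℂ) : wd (-1) (c • v) u z = c * wd (-1) v u z := by
  conv_lhs => rw [← Complex.re_add_im c, mul_comm, add_smul, wd_vec_add, mul_smul,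
    wd_vec_smul_I (by norm_num), wd_vec_smul_real, wd_vec_smul_real]
  conv_rhs => rw [← Complex.re_add_im c]
  ring

/-- The `(0,1)` derivative is conjugate linear in the direction. -/
theorem wd_vec_smul_conj (c : ℂ) :
    wd 1 (c • v) u z = (starRingEnd ℂ) c * wd 1 v u z := by
  conv_lhs => rw [← Complex.re_add_im c, mul_comm, add_smul, wd_vec_add, mul_smul,
    wd_vec_smul_I (by norm_num), wd_vec_smul_real, wd_vec_smul_real]
  conv_rhs => rw [← Complex.re_add_im c, map_add, map_mul, Complex.conj_I, Complex.conj_ofReal,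
    Complex.conj_ofReal]
  ring

theorem wd_vec_zero : wd s (0 : E) u z = 0 := by simp [wd]

theorem wd_vec_sum {ι : Type*} (S : Finset ι) (V : ι → E) :
    wd s (∑ i ∈ S, V i) u z = ∑ i ∈ S, wd s (V i) u z := by
  classical
  induction S using Finset.induction_on with
  | empty => simp [wd_vec_zero]
  | insert i S hi ih => rw [Finset.sum_insert hi, Finset.sum_insert hi, wd_vec_add, ih]

theorem wd_conj (hs : (starRingEnd ℂ) s = s) :
    wd s v (fun w => (starRingEnd ℂ) (u w)) z = (starRingEnd ℂ) (wd (-s) v u z) := by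
  have h : fderiv ℝ (fun w => (starRingEnd ℂ) (u w)) z
      = (Complex.conjCLE : ℂ →L[ℝ] ℂ).comp (fderiv ℝ u z) := by
    have := Complex.conjCLE.comp_fderiv (f := u) (x := z)
    exact this
  simp only [wd, h]
  simp [hs, map_ofNat]

/-- Holomorphic functions satisfy the Cauchy–Riemann equations. -/
theorem wd_of_differentiableAt (h : DifferentiableAt ℂ u z) : wd 1 v u z = 0 := by
  simp only [wd, h.fderiv_restrictScalars ℝ]
  simp [← mul_assoc, Complex.I_mul_I]

/-- Composition with a holomorphic map respects types. -/
theorem wd_comp {F : Type*} [NormedAddCommGroup F] [NormedSpace ℂ F] {τ : F → E} {x v : F}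
    (hu : DifferentiableAt ℝ u (τ x)) (hτ : DifferentiableAt ℂ τ x) :
    wd s v (fun w => u (τ w)) x = wd s (fderiv ℂ τ x v) u (τ x) := by
  have h : fderiv ℝ (fun w => u (τ w)) x = (fderiv ℝ u (τ x)).comp (fderiv ℝ τ x) :=
    fderiv_comp x hu (hτ.restrictScalars ℝ)
  simp only [wd, h, hτ.fderiv_restrictScalars ℝ]
  simp

theorem contDiffAt_wd {n : ℕ∞ω} {k : ℕ∞ω} (h : ContDiffAt ℝ n u z) (hk : k + 1 ≤ n) :
    ContDiffAt ℝ k (wd s v u) z := by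
  have h1 : ContDiffAt ℝ k (fderiv ℝ u) z := h.fderiv_right hk
  unfold wd
  exact ((h1.clm_apply contDiffAt_const).add
    (contDiffAt_const.mul (h1.clm_apply contDiffAt_const))).div_const 2

theorem wd_wd (h : ContDiffAt ℝ 2 u z) : wd s v (wd t v' u) z =
    (fderiv ℝ (fderiv ℝ u) z v v' + t * Complex.I * fderiv ℝ (fderiv ℝ u) z v (Complex.I • v')
      + s * Complex.I * (fderiv ℝ (fderiv ℝ u) z (Complex.I • v) v'
      + t * Complex.I * fderiv ℝ (fderiv ℝ u) z (Complex.I • v) (Complex.I • v'))) / 4 := by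
  have hd : DifferentiableAt ℝ (fderiv ℝ u) z :=
    (h.fderiv_right (m := 1) (by norm_num)).differentiableAt (by norm_num)
  have h1 : ∀ y : E, HasFDerivAt (fun w => fderiv ℝ u w y)
      ((fderiv ℝ (fderiv ℝ u) z).flip y) z := fun y => by
    simpa using hd.hasFDerivAt.clm_apply (hasFDerivAt_const y z)
  have h2 : HasFDerivAt (wd t v' u) ((1 / 2 : ℂ) • ((fderiv ℝ (fderiv ℝ u) z).flip v' +
      (t * Complex.I) • (fderiv ℝ (fderiv ℝ u) z).flip (Complex.I • v'))) z := by
    have := ((h1 v').add ((h1 (Complex.I • v')).const_mul (t * Complex.I))).const_mul (1 / 2 : ℂ)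
    refine this.congr_of_eventuallyEq (Filter.Eventually.of_forall fun w => ?_)
    simp only [wd, Pi.add_apply]
    ring
  rw [wd, h2.fderiv]
  simp only [smul_apply, add_apply,
    ContinuousLinearMap.flip_apply, smul_eq_mul]
  ring

theorem wd_comm (h : ContDiffAt ℝ 2 u z) : wd s v (wd t v' u) z = wd t v' (wd s v u) z := by
  have hs : IsSymmSndFDerivAt ℝ u z := h.isSymmSndFDerivAt (by simp)
  rw [wd_wd h, wd_wd h, hs.eq v v', hs.eq v (Complex.I • v'), hs.eq (Complex.I • v) v',
    hs.eq (Complex.I • v) (Complex.I • v')]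
  ring

/-- The complex Hessian of a real function in a direction is a sum of two second derivatives. -/
theorem wd_wd_ofReal {h : E → ℝ} (hh : ContDiffAt ℝ 2 h z) :
    wd (-1) v (wd 1 v fun w => (h w : ℂ)) z =
      ((fderiv ℝ (fderiv ℝ h) z v v
        + fderiv ℝ (fderiv ℝ h) z (Complex.I • v) (Complex.I • v)) / 4 : ℝ) := by
  have hc : ContDiffAt ℝ 2 (fun w => (h w : ℂ)) z :=
    Complex.ofRealCLM.contDiff.contDiffAt.comp z hh
  have h1 : ∀ᶠ w in nhds z, fderiv ℝ (fun w => (h w : ℂ)) w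
      = Complex.ofRealCLM.comp (fderiv ℝ h w) := by
    filter_upwards [hh.eventually (by simp)] with w hw
    exact (Complex.ofRealCLM.hasFDerivAt.comp w
      (hw.differentiableAt (by norm_num)).hasFDerivAt).fderiv
  have hd : DifferentiableAt ℝ (fderiv ℝ h) z :=
    (hh.fderiv_right (m := 1) (by norm_num)).differentiableAt (by norm_num)
  have h2 : ∀ x y : E, fderiv ℝ (fderiv ℝ (fun w => (h w : ℂ))) z x y
      = (fderiv ℝ (fderiv ℝ h) z x y : ℝ) := fun x y => by
    rw [Filter.EventuallyEq.fderiv_eq h1]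
    have := ((ContinuousLinearMap.compL ℝ E ℝ ℂ Complex.ofRealCLM).hasFDerivAt.comp z
      hd.hasFDerivAt).fderiv
    have h3 : (fun w => Complex.ofRealCLM.comp (fderiv ℝ h w)) =
      (ContinuousLinearMap.compL ℝ E ℝ ℂ Complex.ofRealCLM) ∘ fderiv ℝ h := rfl
    rw [h3, this]
    simp
  have hs : IsSymmSndFDerivAt ℝ h z := hh.isSymmSndFDerivAt (by simp)
  rw [wd_wd hc]
  simp only [h2]
  rw [hs.eq (Complex.I • v) v]
  push_cast
  linear_combination (-1 / 4 * (fderiv ℝ (fderiv ℝ h) z (Complex.I • v) (Complex.I • v) : ℂ)) *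
    Complex.I_mul_I

theorem fderiv_fderiv_nonpos_of_isLocalMax {h : E → ℝ} (hh : ContDiffAt ℝ 2 h z)
    (hmax : IsLocalMax h z) (v : E) : fderiv ℝ (fderiv ℝ h) z v v ≤ 0 := by
  by_contra! hpos
  have hl : ∀ t : ℝ, HasDerivAt (fun t : ℝ => z + t • v) v t := fun t => by
    simpa using ((hasDerivAt_id t).smul_const v).const_add z
  have hz : z + (0 : ℝ) • v = z := by simp
  have hc : Filter.Tendsto (fun t : ℝ => z + t • v) (nhds 0) (nhds z) := by
    have := (hl 0).continuousAt.tendsto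
    rwa [hz] at this
  have h1 : deriv (fun t : ℝ => h (z + t • v)) =ᶠ[nhds 0] fun t => fderiv ℝ h (z + t • v) v := by
    filter_upwards [hc.eventually (hh.eventually (by simp))] with t ht
    exact ((ht.differentiableAt (by norm_num)).hasFDerivAt.comp_hasDerivAt t (hl t)).deriv
  have hd : DifferentiableAt ℝ (fderiv ℝ h) z :=
    (hh.fderiv_right (m := 1) (by norm_num)).differentiableAt (by norm_num)
  have h2 : deriv (deriv fun t : ℝ => h (z + t • v)) 0 = fderiv ℝ (fderiv ℝ h) z v v := by
    rw [h1.deriv_eq]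
    have h3 : HasFDerivAt (fderiv ℝ h) (fderiv ℝ (fderiv ℝ h) z) (z + (0 : ℝ) • v) := by
      rw [hz]; exact hd.hasFDerivAt
    have h4 : HasDerivAt (fun t : ℝ => fderiv ℝ h (z + t • v)) (fderiv ℝ (fderiv ℝ h) z v) 0 :=
      h3.comp_hasDerivAt (0 : ℝ) (hl 0)
    simpa using (h4.clm_apply (hasDerivAt_const (0 : ℝ) v)).deriv
  have hmax' : IsLocalMax (fun t : ℝ => h (z + t • v)) 0 := by
    have := hc.eventually hmax
    filter_upwards [this] with t ht
    simpa using ht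
  have hmin : IsLocalMin (fun t : ℝ => h (z + t • v)) 0 := by
    refine isLocalMin_of_deriv_deriv_pos (h2.symm ▸ hpos) hmax'.deriv_eq_zero ?_
    have h5 : ContinuousAt h (z + (0 : ℝ) • v) := by rw [hz]; exact hh.continuousAt
    exact h5.comp (f := fun t : ℝ => z + t • v) (hl 0).continuousAt
  -- a point that is both a local maximum and a local minimum has a neighbourhood of constancy
  have hconst : (fun t : ℝ => h (z + t • v)) =ᶠ[nhds 0] fun _ => h (z + (0 : ℝ) • v) := by
    filter_upwards [hmax', hmin] with t ht ht'
    exact le_antisymm ht ht'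
  have h4 : deriv (fun t : ℝ => h (z + t • v)) =ᶠ[nhds 0] fun _ => 0 :=
    hconst.deriv.trans (Filter.Eventually.of_forall fun t => by simp)
  rw [h4.deriv_eq] at h2
  simp at h2
  linarith

theorem wd_wd_nonpos_of_isLocalMax {h : E → ℝ} (hh : ContDiffAt ℝ 2 h z)
    (hmax : IsLocalMax h z) (v : E) : (wd (-1) v (wd 1 v fun w => (h w : ℂ)) z).re ≤ 0 := by
  rw [wd_wd_ofReal hh, Complex.ofReal_re]
  have h1 := fderiv_fderiv_nonpos_of_isLocalMax hh hmax v
  have h2 := fderiv_fderiv_nonpos_of_isLocalMax hh hmax (Complex.I • v)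
  linarith

theorem wd_eq_zero_of_isLocalMax {h : E → ℝ} (hh : DifferentiableAt ℝ h z)
    (hmax : IsLocalMax h z) : wd s v (fun w => (h w : ℂ)) z = 0 := by
  have : fderiv ℝ (fun w => (h w : ℂ)) z = 0 := by
    have := (Complex.ofRealCLM.hasFDerivAt.comp z hh.hasFDerivAt).fderiv
    rw [hmax.fderiv_eq_zero] at this
    simpa [Function.comp_def] using this
  simp [wd, this]

end Wirtinger

/-! ### Entrywise calculus of matrix valued functions -/

section MatrixCalculus

variable {E : Type*} [NormedAddCommGroup E] [NormedSpace ℂ E]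
variable {ι κ μ : Type*} {s : ℂ} {v v' : E} {z : E}

/-- The entrywise `wd` of a matrix valued function. -/
noncomputable def wdM (s : ℂ) (v : E) (F : E → Matrix ι κ ℂ) (z : E) : Matrix ι κ ℂ :=
  Matrix.of fun i j => wd s v (fun w => F w i j) z

/-- A matrix valued function is `C^n` at a point if its entries are. -/
def MatContDiffAt (n : ℕ∞ω) (F : E → Matrix ι κ ℂ) (z : E) : Prop :=
  ∀ i j, ContDiffAt ℝ n (fun w => F w i j) z

theorem MatContDiffAt.eventually {n : ℕ∞ω} {F : E → Matrix ι κ ℂ} [Finite ι] [Finite κ]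
    (h : MatContDiffAt n F z) (hn : n ≠ ∞) : ∀ᶠ w in nhds z, MatContDiffAt n F w := by
  simp only [MatContDiffAt, Filter.eventually_all]
  exact fun i j => (h i j).eventually hn

theorem MatContDiffAt.of_le {n k : ℕ∞ω} {F : E → Matrix ι κ ℂ} (h : MatContDiffAt n F z)
    (hk : k ≤ n) : MatContDiffAt k F z := fun i j => (h i j).of_le hk

theorem MatContDiffAt.diff {n : ℕ∞ω} {F : E → Matrix ι κ ℂ} (h : MatContDiffAt n F z)
    (hn : n ≠ 0) (i : ι) (j : κ) : DifferentiableAt ℝ (fun w => F w i j) z :=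
  (h i j).differentiableAt hn

theorem MatContDiffAt.wdM {n k : ℕ∞ω} {F : E → Matrix ι κ ℂ} (h : MatContDiffAt n F z)
    (hk : k + 1 ≤ n) : MatContDiffAt k (wdM s v F) z := fun i j => contDiffAt_wd (h i j) hk

theorem MatContDiffAt.add {n : ℕ∞ω} {F F' : E → Matrix ι κ ℂ} (h : MatContDiffAt n F z)
    (h' : MatContDiffAt n F' z) : MatContDiffAt n (fun w => F w + F' w) z :=
  fun i j => (h i j).add (h' i j)

theorem MatContDiffAt.sub {n : ℕ∞ω} {F F' : E → Matrix ι κ ℂ} (h : MatContDiffAt n F z)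
    (h' : MatContDiffAt n F' z) : MatContDiffAt n (fun w => F w - F' w) z :=
  fun i j => (h i j).sub (h' i j)

theorem MatContDiffAt.mul {n : ℕ∞ω} [Fintype κ] {F : E → Matrix ι κ ℂ} {F' : E → Matrix κ μ ℂ}
    (h : MatContDiffAt n F z) (h' : MatContDiffAt n F' z) :
    MatContDiffAt n (fun w => F w * F' w) z := by
  intro i j
  simp only [Matrix.mul_apply]
  exact ContDiffAt.sum fun k _ => (h i k).mul (h' k j)

theorem MatContDiffAt.trace {n : ℕ∞ω} [Fintype κ] {F : E → Matrix κ κ ℂ}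
    (h : MatContDiffAt n F z) : ContDiffAt ℝ n (fun w => (F w).trace) z := by
  simp only [Matrix.trace, Matrix.diag_apply]
  exact ContDiffAt.sum fun k _ => h k k

theorem MatContDiffAt.det {n : ℕ∞ω} [Fintype κ] [DecidableEq κ] {F : E → Matrix κ κ ℂ}
    (h : MatContDiffAt n F z) : ContDiffAt ℝ n (fun w => (F w).det) z := by
  simp only [Matrix.det_apply]
  exact ContDiffAt.sum fun σ _ => (contDiffAt_prod fun i _ => h (σ i) i).const_smul _

theorem MatContDiffAt.inv {n : ℕ∞ω} [Fintype κ] [DecidableEq κ] {F : E → Matrix κ κ ℂ}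
    (h : MatContDiffAt n F z) (h0 : (F z).det ≠ 0) : MatContDiffAt n (fun w => (F w)⁻¹) z := by
  intro i j
  have h1 : ContDiffAt ℝ n (fun w => ((F w).det)⁻¹) z := h.det.inv h0
  have h2 : ContDiffAt ℝ n (fun w => (F w).adjugate i j) z := by
    simp only [Matrix.adjugate_apply]
    refine MatContDiffAt.det fun a b => ?_
    by_cases hj : a = j
    · subst hj
      simpa using! contDiffAt_const
    · simpa [Matrix.updateRow_ne hj] using h a b
  simpa [Matrix.inv_def, Ring.inverse_eq_inv'] using! h1.mul h2

theorem MatContDiffAt.eventually_det_ne [Fintype κ] [DecidableEq κ] {n : ℕ∞ω}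
    {F : E → Matrix κ κ ℂ} (h : MatContDiffAt n F z) (h0 : (F z).det ≠ 0) :
    ∀ᶠ w in nhds z, (F w).det ≠ 0 :=
  h.det.continuousAt.eventually_ne h0

theorem wdM_congr {F F' : E → Matrix ι κ ℂ} (h : F =ᶠ[nhds z] F') :
    wdM s v F z = wdM s v F' z := by
  ext i j
  exact wd_congr (h.mono fun w hw => by simp only [hw])

theorem wdM_add {F F' : E → Matrix ι κ ℂ} (h : MatContDiffAt 1 F z)
    (h' : MatContDiffAt 1 F' z) :
    wdM s v (fun w => F w + F' w) z = wdM s v F z + wdM s v F' z := by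
  ext i j
  exact wd_add (h.diff (by norm_num) i j) (h'.diff (by norm_num) i j)

theorem wdM_sub {F F' : E → Matrix ι κ ℂ} (h : MatContDiffAt 1 F z)
    (h' : MatContDiffAt 1 F' z) :
    wdM s v (fun w => F w - F' w) z = wdM s v F z - wdM s v F' z := by
  ext i j
  exact wd_sub (h.diff (by norm_num) i j) (h'.diff (by norm_num) i j)

theorem wdM_mul [Fintype κ] {F : E → Matrix ι κ ℂ} {F' : E → Matrix κ μ ℂ}
    (h : MatContDiffAt 1 F z) (h' : MatContDiffAt 1 F' z) :
    wdM s v (fun w => F w * F' w) z = wdM s v F z * F' z + F z * wdM s v F' z := by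
  ext i j
  simp only [wdM, Matrix.of_apply, Matrix.mul_apply, Matrix.add_apply]
  rw [wd_sum _ fun k _ => (h.diff (by norm_num) i k).fun_mul (h'.diff (by norm_num) k j),
    ← Finset.sum_add_distrib]
  exact Finset.sum_congr rfl fun k _ => wd_mul (h.diff (by norm_num) i k)
    (h'.diff (by norm_num) k j)

theorem wd_trace [Fintype κ] {F : E → Matrix κ κ ℂ} (h : MatContDiffAt 1 F z) :
    wd s v (fun w => (F w).trace) z = (wdM s v F z).trace := by
  simp only [Matrix.trace, Matrix.diag_apply]
  exact wd_sum _ fun k _ => h.diff (by norm_num) k k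

theorem wdM_inv [Fintype κ] [DecidableEq κ] {F : E → Matrix κ κ ℂ} (h : MatContDiffAt 1 F z)
    (h0 : (F z).det ≠ 0) :
    wdM s v (fun w => (F w)⁻¹) z = -((F z)⁻¹ * wdM s v F z * (F z)⁻¹) := by
  have h1 : wdM s v (fun w => (F w)⁻¹ * F w) z = 0 := by
    have : (fun w => (F w)⁻¹ * F w) =ᶠ[nhds z] fun _ => 1 := by
      filter_upwards [h.eventually_det_ne h0] with w hw
      exact Matrix.nonsing_inv_mul _ (isUnit_iff_ne_zero.2 hw)
    rw [wdM_congr this]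
    ext i j
    exact wd_const _
  rw [wdM_mul (h.inv h0) h] at h1
  have h2 : F z * (F z)⁻¹ = 1 := Matrix.mul_nonsing_inv _ (isUnit_iff_ne_zero.2 h0)
  have h3 := congrArg (· * (F z)⁻¹) h1
  simp only [add_mul, zero_mul, mul_assoc, h2, mul_one] at h3
  rw [eq_neg_iff_add_eq_zero, mul_assoc, h3]

theorem wd_prod [DecidableEq ι] (S : Finset ι) {U : ι → E → ℂ}
    (h : ∀ i ∈ S, DifferentiableAt ℝ (U i) z) :
    wd s v (fun w => ∏ i ∈ S, U i w) z
      = ∑ i ∈ S, (∏ j ∈ S.erase i, U j z) * wd s v (U i) z := by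
  have h1 : HasFDerivAt (fun w => ∏ i ∈ S, U i w)
      (∑ i ∈ S, (∏ j ∈ S.erase i, U j z) • fderiv ℝ (U i) z) z :=
    HasFDerivAt.finsetProd fun i hi => (h i hi).hasFDerivAt
  simp only [wd, h1.fderiv, sum_apply, smul_apply, smul_eq_mul, Finset.mul_sum,
    ← Finset.sum_add_distrib, Finset.sum_div]
  exact Finset.sum_congr rfl fun i _ => by ring

/-- Jacobi's formula. -/
theorem wd_det [Fintype κ] [DecidableEq κ] {F : E → Matrix κ κ ℂ} (h : MatContDiffAt 1 F z)
    (h0 : (F z).det ≠ 0) :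
    wd s v (fun w => (F w).det) z = (F z).det * ((F z)⁻¹ * wdM s v F z).trace := by
  have hd := fun i j => h.diff (by norm_num) i j
  have hp : ∀ σ : Equiv.Perm κ, DifferentiableAt ℝ (fun w => ∏ i, F w (σ i) i) z := fun σ =>
    (HasFDerivAt.finsetProd fun i _ => (hd (σ i) i).hasFDerivAt).differentiableAt
  have h1 : wd s v (fun w => (F w).det) z
      = ∑ i, ((F z).updateCol i fun k => wdM s v F z k i).det := by
    simp only [Matrix.det_apply']
    rw [wd_sum _ fun σ _ => (hp σ).const_mul _,
      Finset.sum_comm]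
    refine Finset.sum_congr rfl fun σ _ => ?_
    rw [wd_mul (differentiableAt_const _) (hp σ),
      wd_const, wd_prod _ fun i _ => hd (σ i) i, zero_mul, zero_add, Finset.mul_sum]
    refine Finset.sum_congr rfl fun i _ => ?_
    rw [← Finset.mul_prod_erase Finset.univ _ (Finset.mem_univ i), Matrix.updateCol_self,
      mul_comm (∏ j ∈ _, _)]
    congr 2
    refine Finset.prod_congr rfl fun j hj => ?_
    rw [Matrix.updateCol_ne (Finset.ne_of_mem_erase hj)]
  have h2 : (F z).adjugate = (F z).det • (F z)⁻¹ := by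
    rw [Matrix.inv_def, smul_smul, Ring.inverse_eq_inv', mul_inv_cancel₀ h0, one_smul]
  rw [h1, ← smul_eq_mul, ← Matrix.trace_smul, ← Matrix.smul_mul, ← h2]
  refine Finset.sum_congr rfl fun i _ => ?_
  rw [← Matrix.cramer_apply, Matrix.cramer_eq_adjugate_mulVec]
  rfl

end MatrixCalculus

/-! ### Frames adapted to two Hermitian forms -/

section Frames

open Matrix

variable {n : Type*} [Fintype n]

/-- The Hermitian form `∑ X_{ab} x^a ȳ^b` of a matrix. -/
def sesq (X : Matrix n n ℂ) (x y : n → ℂ) : ℂ :=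
  ∑ a, ∑ b, X a b * x a * (starRingEnd ℂ) (y b)

/-- The `i`-th vector of the frame given by the complex conjugate of a matrix, so that
`Wᴴ * X * W` has the entries `X(u_i, ū_j)`. -/
def frameVec (W : Matrix n n ℂ) (i : n) : n → ℂ := fun a => (starRingEnd ℂ) (W a i)

theorem sesq_frameVec (X W : Matrix n n ℂ) (i j : n) :
    sesq X (frameVec W i) (frameVec W j) = (Wᴴ * X * W) i j := by
  simp only [sesq, frameVec, Matrix.mul_apply, Finset.sum_mul, conjTranspose_apply,
    Complex.conj_conj]
  rw [Finset.sum_comm]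
  refine Finset.sum_congr rfl fun b _ => Finset.sum_congr rfl fun a _ => ?_
  rw [mul_comm (X a b)]
  rfl

variable [DecidableEq n]

theorem exists_diagonalization {A : Matrix n n ℂ} (hA : A.PosDef) :
    ∃ (U : Matrix n n ℂ) (d : n → ℝ), Uᴴ * U = 1 ∧ (∀ i, 0 < d i) ∧
      Uᴴ * A * U = diagonal fun i => (d i : ℂ) := by
  refine ⟨hA.1.eigenvectorUnitary, hA.1.eigenvalues, ?_, hA.eigenvalues_pos, ?_⟩
  · exact Unitary.coe_star_mul_self _
  · have := hA.1.conjStarAlgAut_star_eigenvectorUnitary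
    rw [Unitary.conjStarAlgAut_star_apply] at this
    exact this

/-- Two positive definite Hermitian forms have a common orthogonal basis, orthonormal for the
first. -/
theorem exists_simultaneous_diagonalization {A B : Matrix n n ℂ} (hA : A.PosDef)
    (hB : B.PosDef) :
    ∃ (W : Matrix n n ℂ) (d : n → ℝ), Wᴴ * A * W = 1 ∧ (∀ i, 0 < d i) ∧
      Wᴴ * B * W = diagonal fun i => (d i : ℂ) := by
  obtain ⟨U, d, hU, hd, hUA⟩ := exists_diagonalization hA
  set D : Matrix n n ℂ := diagonal fun i => (((Real.sqrt (d i))⁻¹ : ℝ) : ℂ) with hD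
  have hDH : Dᴴ = D := by
    rw [hD, diagonal_conjTranspose]
    congr 1
    ext i
    exact Complex.conj_ofReal _
  have hV : (U * D)ᴴ * A * (U * D) = 1 := by
    have : (U * D)ᴴ * A * (U * D) = D * (Uᴴ * A * U) * D := by
      rw [conjTranspose_mul, hDH]; noncomm_ring
    rw [this, hUA, hD, diagonal_mul_diagonal, diagonal_mul_diagonal, ← diagonal_one]
    congr 1
    ext i
    rw [← Complex.ofReal_mul, ← Complex.ofReal_mul]
    have h := Real.sqrt_ne_zero'.2 (hd i)
    have h2 := Real.mul_self_sqrt (hd i).le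
    have : (Real.sqrt (d i))⁻¹ * d i * (Real.sqrt (d i))⁻¹ = 1 := by
      field_simp
      nlinarith
    rw [this, Complex.ofReal_one]
  have hinj : Function.Injective (U * D).mulVec := by
    have hu : IsUnit (U * D) := by
      rw [isUnit_iff_isUnit_det]
      have := congrArg det hV
      rw [det_mul, det_one] at this
      exact IsUnit.of_mul_eq_one_right _ this
    exact mulVec_injective_of_isUnit hu
  obtain ⟨U', d', hU', hd', hUB⟩ :=
    exists_diagonalization (hB.conjTranspose_mul_mul_same hinj)
  refine ⟨U * D * U', d', ?_, hd', ?_⟩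
  · have : (U * D * U')ᴴ * A * (U * D * U') = U'ᴴ * ((U * D)ᴴ * A * (U * D)) * U' := by
      rw [conjTranspose_mul _ U']; noncomm_ring
    rw [this, hV, mul_one, hU']
  · rw [← hUB, conjTranspose_mul _ U']; noncomm_ring

theorem inv_eq_of_frame {A W : Matrix n n ℂ} (h : Wᴴ * A * W = 1) : A⁻¹ = W * Wᴴ := by
  have h2 : W * (Wᴴ * A) = 1 := mul_eq_one_comm.1 h
  exact inv_eq_left_inv (by rw [mul_assoc, h2])

theorem inv_eq_of_frame_diagonal {A B W : Matrix n n ℂ} {d : n → ℝ} (h : Wᴴ * A * W = 1)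
    (hd : ∀ i, 0 < d i) (hB : Wᴴ * B * W = diagonal fun i => (d i : ℂ)) :
    B⁻¹ = W * (diagonal fun i => ((d i)⁻¹ : ℂ)) * Wᴴ := by
  have h2 : W * (Wᴴ * A) = 1 := mul_eq_one_comm.1 h
  have h3 : Wᴴ * (A * W) = 1 := by rw [← mul_assoc, h]
  have h4 : (A * W) * Wᴴ = 1 := mul_eq_one_comm.1 h3
  refine inv_eq_left_inv ?_
  calc W * (diagonal fun i => ((d i)⁻¹ : ℂ)) * Wᴴ * B
      = W * (diagonal fun i => ((d i)⁻¹ : ℂ)) * (Wᴴ * B * W) * (Wᴴ * A) := by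
        simp only [mul_assoc, h2, mul_one]
    _ = 1 := by
        rw [hB, mul_assoc W, diagonal_mul_diagonal, ← h2]
        have : (fun i => ((d i)⁻¹ : ℂ) * (d i : ℂ)) = fun _ => 1 := by
          ext i
          exact inv_mul_cancel₀ (by exact_mod_cast (hd i).ne')
        rw [this, diagonal_one, mul_one]

theorem trace_frame_diagonal (X W : Matrix n n ℂ) (d : n → ℂ) :
    (W * diagonal d * Wᴴ * X).trace = ∑ i, d i * sesq X (frameVec W i) (frameVec W i) := by
  have : (W * diagonal d * Wᴴ * X).trace = (diagonal d * (Wᴴ * X * W)).trace := by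
    rw [mul_assoc, mul_assoc, trace_mul_comm]
    simp only [mul_assoc]
  rw [this]
  simp only [Matrix.trace, diag_apply, diagonal_mul, sesq_frameVec]

theorem trace_frame (X W : Matrix n n ℂ) :
    (W * Wᴴ * X).trace = ∑ i, sesq X (frameVec W i) (frameVec W i) := by
  simpa using trace_frame_diagonal X W fun _ => 1

/-- The Cauchy–Schwarz inequality behind the estimate of the gradient of the trace: in an adapted
frame, `|tr (g⁻¹E)|² ≤ tr(g⁻¹g̃) · tr(g⁻¹ E g̃⁻¹ Eᴴ)`. -/
theorem norm_trace_sq_le {A B W : Matrix n n ℂ} {d : n → ℝ} (h : Wᴴ * A * W = 1)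
    (hd : ∀ i, 0 < d i) (hB : Wᴴ * B * W = diagonal fun i => (d i : ℂ)) (X : Matrix n n ℂ) :
    ‖(A⁻¹ * X).trace‖ ^ 2 ≤ (∑ i, d i) * ((A⁻¹ * X * B⁻¹ * Xᴴ).trace).re := by
  rw [inv_eq_of_frame_diagonal h hd hB, inv_eq_of_frame h]
  set N : Matrix n n ℂ := Wᴴ * X * W with hN
  have h1 : (W * Wᴴ * X).trace = N.trace := by
    rw [hN, mul_assoc, trace_mul_comm]
  have h2 : (W * Wᴴ * X * (W * (diagonal fun i => ((d i)⁻¹ : ℂ)) * Wᴴ) * Xᴴ).trace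
      = (N * (diagonal fun i => ((d i)⁻¹ : ℂ)) * Nᴴ).trace := by
    have : Nᴴ = Wᴴ * Xᴴ * W := by
      rw [hN, conjTranspose_mul, conjTranspose_mul, conjTranspose_conjTranspose, mul_assoc]
    rw [this, hN]
    have e : W * Wᴴ * X * (W * (diagonal fun i => ((d i)⁻¹ : ℂ)) * Wᴴ) * Xᴴ
      = W * (Wᴴ * X * (W * (diagonal fun i => ((d i)⁻¹ : ℂ)) * Wᴴ) * Xᴴ) := by noncomm_ring
    rw [e, trace_mul_comm]
    congr 1
    noncomm_ring
  have h3 : (N * (diagonal fun i => ((d i)⁻¹ : ℂ)) * Nᴴ).trace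
      = ((∑ j, ∑ k, (d k)⁻¹ * ‖N j k‖ ^ 2 : ℝ) : ℂ) := by
    push_cast
    refine Finset.sum_congr rfl fun j _ => ?_
    rw [diag_apply, Matrix.mul_apply]
    refine Finset.sum_congr rfl fun k _ => ?_
    rw [mul_diagonal, conjTranspose_apply, ← Complex.mul_conj' (N j k)]
    change _ * _ * (starRingEnd ℂ) _ = _
    ring
  rw [h1, h2, h3, Complex.ofReal_re]
  have h4 : ‖N.trace‖ ^ 2 ≤ (∑ i, ‖N i i‖) ^ 2 := by
    gcongr
    exact norm_sum_le _ _
  have h5 : (∑ i, ‖N i i‖) ^ 2 ≤ (∑ i, d i) * ∑ i, (d i)⁻¹ * ‖N i i‖ ^ 2 := by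
    refine Finset.sum_sq_le_sum_mul_sum_of_sq_le_mul _ (fun i _ => (hd i).le)
      (fun i _ => mul_nonneg (inv_nonneg.2 (hd i).le) (sq_nonneg _)) fun i _ => ?_
    rw [← mul_assoc, mul_inv_cancel₀ (hd i).ne', one_mul]
  refine h4.trans (h5.trans ?_)
  refine mul_le_mul_of_nonneg_left ?_ (Finset.sum_nonneg fun i _ => (hd i).le)
  refine Finset.sum_le_sum fun j _ => ?_
  exact Finset.single_le_sum (f := fun k => (d k)⁻¹ * ‖N j k‖ ^ 2)
    (fun k _ => mul_nonneg (inv_nonneg.2 (hd k).le) (sq_nonneg _)) (Finset.mem_univ j)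

end Frames

/-! ### Curvature and the second order identities -/

section LocalGeometry

open Matrix

variable {E : Type*} [NormedAddCommGroup E] [NormedSpace ℂ E]
variable {n : Type*} [Fintype n] [DecidableEq n] {s : ℂ} {v v' : E} {z : E}

/-- The curvature of the Chern connection of the Hermitian metric with matrix `G`, evaluated on the
directions `v` and `v̄'`: the matrix `-∂∂̄G + ∂G · G⁻¹ · ∂̄G`. -/
noncomputable def chernCurv (G : E → Matrix n n ℂ) (z : E) (v v' : E) : Matrix n n ℂ :=
  -wdM (-1) v (wdM 1 v' G) z + wdM (-1) v G z * (G z)⁻¹ * wdM 1 v' G z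

theorem wdM_inv_mul_wdM {G : E → Matrix n n ℂ} (hG : MatContDiffAt 2 G z)
    (h0 : (G z).det ≠ 0) :
    wdM (-1) v (fun w => (G w)⁻¹ * wdM 1 v' G w) z = -((G z)⁻¹ * chernCurv G z v v') := by
  have h1 : MatContDiffAt 1 G z := hG.of_le (by norm_num)
  rw [wdM_mul (h1.inv h0) (hG.wdM (by norm_num)), wdM_inv h1 h0, chernCurv]
  noncomm_ring

/-- The complex Hessian of the trace `tr(g⁻¹g̃)`: the curvature of both metrics and a term
quadratic in the covariant derivative of `g̃`. -/
theorem wd_wd_trace_inv_mul {G H : E → Matrix n n ℂ} (hG : MatContDiffAt 2 G z)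
    (hH : MatContDiffAt 2 H z) (hG0 : (G z).det ≠ 0) (hH0 : (H z).det ≠ 0) :
    wd (-1) v (wd 1 v' fun w => ((G w)⁻¹ * H w).trace) z =
      ((G z)⁻¹ * chernCurv G z v v' * (G z)⁻¹ * H z).trace
      - ((G z)⁻¹ * chernCurv H z v v').trace
      + ((G z)⁻¹ * (wdM (-1) v H z - wdM (-1) v G z * (G z)⁻¹ * H z) * (H z)⁻¹
          * (wdM 1 v' H z - H z * (G z)⁻¹ * wdM 1 v' G z)).trace := by
  have hG1 : MatContDiffAt 1 G z := hG.of_le (by norm_num)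
  have hH1 : MatContDiffAt 1 H z := hH.of_le (by norm_num)
  have hGd : MatContDiffAt 1 (wdM 1 v' G) z := hG.wdM (by norm_num)
  have hHd : MatContDiffAt 1 (wdM 1 v' H) z := hH.wdM (by norm_num)
  have hI := hG1.inv hG0
  have near : (wd 1 v' fun w => ((G w)⁻¹ * H w).trace) =ᶠ[nhds z] fun w =>
      ((G w)⁻¹ * wdM 1 v' H w - (G w)⁻¹ * wdM 1 v' G w * ((G w)⁻¹ * H w)).trace := by
    filter_upwards [hG1.eventually (by simp), hH1.eventually (by simp),
      hG1.eventually_det_ne hG0] with w h1 h2 h3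
    rw [wd_trace ((h1.inv h3).mul h2), wdM_mul (h1.inv h3) h2, wdM_inv h1 h3]
    congr 1
    noncomm_ring
  rw [wd_congr near, wd_trace ((hI.mul hHd).sub ((hI.mul hGd).mul (hI.mul hH1))),
    wdM_sub (hI.mul hHd) ((hI.mul hGd).mul (hI.mul hH1)), wdM_mul hI hHd,
    wdM_mul (hI.mul hGd) (hI.mul hH1), wdM_inv_mul_wdM hG hG0, wdM_mul hI hH1, wdM_inv hG1 hG0]
  simp only [chernCurv]
  have hHH : H z * (H z)⁻¹ = 1 := mul_nonsing_inv _ (isUnit_iff_ne_zero.2 hH0)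
  have hHH' : (H z)⁻¹ * H z = 1 := nonsing_inv_mul _ (isUnit_iff_ne_zero.2 hH0)
  generalize wdM (-1) v (wdM 1 v' H) z = DH
  generalize wdM (-1) v (wdM 1 v' G) z = DG
  generalize wdM (-1) v G z = A
  generalize wdM (-1) v H z = B
  generalize wdM 1 v' G z = A'
  generalize wdM 1 v' H z = B'
  generalize (G z)⁻¹ = P at *
  generalize (H z)⁻¹ = Q at *
  generalize H z = K at *
  have e : P * (B - A * P * K) * Q * (B' - K * P * A')
      = P * B * Q * B' - P * B * (Q * K) * P * A' - P * A * P * (K * Q) * B'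
        + P * A * P * (K * Q) * (K * P * A') := by noncomm_ring
  rw [e, hHH, hHH']
  have c1 : (P * A' * (P * A * P * K)).trace = (P * A * P * K * (P * A')).trace :=
    trace_mul_comm _ _
  have c2 : (P * A' * (P * B)).trace = (P * B * (P * A')).trace := trace_mul_comm _ _
  simp only [mul_add, add_mul, neg_mul, mul_neg, trace_add, trace_sub, trace_neg,
    mul_one, ← mul_assoc] at c1 c2 ⊢
  linear_combination c1 - c2

/-- The complex Hessian of the logarithm of the determinant is minus the Ricci form: this is the
Calabi–Yau equation `det g̃ = e^f det g` differentiated twice. -/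
theorem wd_wd_of_det_eq {G H : E → Matrix n n ℂ} {f : E → ℂ} (hG : MatContDiffAt 2 G z)
    (hH : MatContDiffAt 2 H z) (hG0 : (G z).det ≠ 0) (hH0 : (H z).det ≠ 0)
    (hf : ContDiffAt ℝ 2 f z)
    (heq : ∀ᶠ w in nhds z, (H w).det = Complex.exp (f w) * (G w).det) :
    ((H z)⁻¹ * chernCurv H z v v').trace
      = ((G z)⁻¹ * chernCurv G z v v').trace - wd (-1) v (wd 1 v' f) z := by
  have hG1 : MatContDiffAt 1 G z := hG.of_le (by norm_num)
  have hH1 : MatContDiffAt 1 H z := hH.of_le (by norm_num)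
  have near : (fun w => ((H w)⁻¹ * wdM 1 v' H w).trace) =ᶠ[nhds z]
      fun w => wd 1 v' f w + ((G w)⁻¹ * wdM 1 v' G w).trace := by
    filter_upwards [hG1.eventually (by simp), hH1.eventually (by simp),
      hG1.eventually_det_ne hG0, hH1.eventually_det_ne hH0, heq.eventually_nhds,
      hf.eventually (by simp), heq] with w h1 h2 h3 h4 h5 h6 h7
    have hfd : DifferentiableAt ℝ f w := h6.differentiableAt (by norm_num)
    have hexp : wd 1 v' (fun y => Complex.exp (f y)) w = Complex.exp (f w) * wd 1 v' f w := by
      have : HasFDerivAt (fun y => Complex.exp (f y)) (Complex.exp (f w) • fderiv ℝ f w) w :=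
        hfd.hasFDerivAt.cexp
      simp only [wd, this.fderiv, _root_.smul_apply, smul_eq_mul]
      ring
    have := wd_congr (s := 1) (v := v') h5
    rw [wd_det h2 h4, wd_mul hfd.cexp (h1.det.differentiableAt (by norm_num)), wd_det h1 h3,
      hexp, h7] at this
    have hne : Complex.exp (f w) * (G w).det ≠ 0 := mul_ne_zero (Complex.exp_ne_zero _) h3
    refine mul_left_cancel₀ hne (this.trans ?_)
    ring
  have := wd_congr (s := -1) (v := v) near
  have k1 := (hG1.inv hG0).mul (hG.wdM (s := 1) (v := v') (k := 1) (by norm_num))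
  have k2 := (hH1.inv hH0).mul (hH.wdM (s := 1) (v := v') (k := 1) (by norm_num))
  rw [wd_trace k2, wd_add ((contDiffAt_wd (k := 1) hf (by norm_num)).differentiableAt
    (by norm_num)) (k1.trace.differentiableAt (by norm_num)), wd_trace k1,
    wdM_inv_mul_wdM hG hG0, wdM_inv_mul_wdM hH hH0, trace_neg, trace_neg] at this
  linear_combination -this

end LocalGeometry

/-! ### Coordinates on `ℂ^m` and Kähler symmetries -/

section Coordinates

open Matrix

variable {m : ℕ} {z : Cn m}

/-- The coordinate vector `∂/∂z^a`. -/
noncomputable def basisVec (a : Fin m) : Cn m := EuclideanSpace.single a 1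

/-- The vector `∑ u^a ∂/∂z^a` with the components `u`. -/
noncomputable def vec (u : Fin m → ℂ) : Cn m := ∑ a, u a • basisVec a

theorem single_I (a : Fin m) : EuclideanSpace.single a Complex.I = Complex.I • basisVec a := by
  ext b
  simp [basisVec]

theorem dz_eq_wd (a : Fin m) : dz a = wd (-1) (basisVec a) := by
  funext u w
  simp only [dz, wd, single_I, basisVec]
  ring

theorem dzbar_eq_wd (a : Fin m) : dzbar a = wd 1 (basisVec a) := by
  funext u w
  simp only [dzbar, wd, single_I, basisVec]
  ring

theorem wd_vec (u : Fin m → ℂ) (h : Cn m → ℂ) (w : Cn m) :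
    wd (-1) (vec u) h w = ∑ a, u a * wd (-1) (basisVec a) h w := by
  simp only [vec, wd_vec_sum, wd_vec_smul]

theorem wd_vec_conj (u : Fin m → ℂ) (h : Cn m → ℂ) (w : Cn m) :
    wd 1 (vec u) h w = ∑ a, (starRingEnd ℂ) (u a) * wd 1 (basisVec a) h w := by
  simp only [vec, wd_vec_sum, wd_vec_smul_conj]

theorem wd_wd_vec {h : Cn m → ℂ} (hh : ContDiffAt ℝ 2 h z) (u u' : Fin m → ℂ) :
    wd (-1) (vec u) (wd 1 (vec u') h) z = ∑ a, ∑ b,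
      wd (-1) (basisVec a) (wd 1 (basisVec b) h) z * u a * (starRingEnd ℂ) (u' b) := by
  have h1 : wd 1 (vec u') h
      = fun w => ∑ b, (starRingEnd ℂ) (u' b) * wd 1 (basisVec b) h w :=
    funext fun w => wd_vec_conj u' h w
  have hd : ∀ b, DifferentiableAt ℝ (wd 1 (basisVec b) h) z := fun b =>
    (contDiffAt_wd (k := 1) hh (by norm_num)).differentiableAt (by norm_num)
  rw [wd_vec]
  refine Finset.sum_congr rfl fun a _ => ?_
  rw [h1, wd_sum _ fun b _ => (hd b).const_mul _, Finset.mul_sum]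
  refine Finset.sum_congr rfl fun b _ => ?_
  rw [wd_mul (differentiableAt_const _) (hd b), wd_const]
  ring

theorem complexHessian_apply (u : Cn m → ℂ) (w : Cn m) (a b : Fin m) :
    complexHessian u w a b = wd (-1) (basisVec a) (wd 1 (basisVec b) u) w := by
  simp only [complexHessian, of_apply, dz_eq_wd, dzbar_eq_wd]

theorem wd_wd_eq_sesq {h : Cn m → ℂ} (hh : ContDiffAt ℝ 2 h z) (u : Fin m → ℂ) :
    wd (-1) (vec u) (wd 1 (vec u) h) z = sesq (complexHessian h z) u u := by
  rw [wd_wd_vec hh, sesq]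
  simp only [complexHessian_apply]

theorem chernCurv_vec {G : Cn m → Matrix (Fin m) (Fin m) ℂ} (hG : MatContDiffAt 2 G z)
    (u u' : Fin m → ℂ) (c d : Fin m) :
    chernCurv G z (vec u) (vec u') c d = ∑ a, ∑ b,
      chernCurv G z (basisVec a) (basisVec b) c d * u a * (starRingEnd ℂ) (u' b) := by
  have h1 : wdM (-1) (vec u) G z = ∑ a, u a • wdM (-1) (basisVec a) G z := by
    ext i j
    simp only [wdM, of_apply, wd_vec, Matrix.sum_apply, Matrix.smul_apply, smul_eq_mul]
  have h2 : wdM 1 (vec u') G z = ∑ a, (starRingEnd ℂ) (u' a) • wdM 1 (basisVec a) G z := by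
    ext i j
    simp only [wdM, of_apply, wd_vec_conj, Matrix.sum_apply, Matrix.smul_apply, smul_eq_mul]
  have h3 : wdM (-1) (vec u) (wdM 1 (vec u') G) z c d = ∑ a, ∑ b,
      wdM (-1) (basisVec a) (wdM 1 (basisVec b) G) z c d * u a * (starRingEnd ℂ) (u' b) :=
    wd_wd_vec (hG c d) u u'
  simp only [chernCurv, Matrix.add_apply, Matrix.neg_apply, h3, add_mul, Finset.sum_add_distrib,
    neg_mul, Finset.sum_neg_distrib]
  congr 1
  rw [h1, h2]
  simp only [Matrix.sum_mul, Matrix.smul_mul, Matrix.mul_smul, Matrix.sum_apply,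
    Matrix.smul_apply, smul_eq_mul, Finset.mul_sum]
  rw [Finset.sum_comm]
  exact Finset.sum_congr rfl fun a _ => Finset.sum_congr rfl fun b _ => by ring

/-- The curvature form `R(u, ū, v, v̄)` of the Hermitian metric with matrix `G`. -/
noncomputable def bisect (G : Cn m → Matrix (Fin m) (Fin m) ℂ) (z : Cn m) (u v : Fin m → ℂ) : ℂ :=
  sesq (chernCurv G z (vec u) (vec u)) v v

theorem bisect_eq {G : Cn m → Matrix (Fin m) (Fin m) ℂ} (hG : MatContDiffAt 2 G z)
    (u v : Fin m → ℂ) :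
    bisect G z u v = ∑ a, ∑ b, ∑ c, ∑ d, chernCurv G z (basisVec a) (basisVec b) c d
      * u a * (starRingEnd ℂ) (u b) * v c * (starRingEnd ℂ) (v d) := by
  simp only [bisect, sesq, chernCurv_vec hG, Finset.sum_mul]
  have : ∀ f : Fin m → Fin m → Fin m → Fin m → ℂ,
      ∑ c, ∑ d, ∑ a, ∑ b, f a b c d = ∑ a, ∑ b, ∑ c, ∑ d, f a b c d := fun f => by
    calc ∑ c, ∑ d, ∑ a, ∑ b, f a b c d = ∑ c, ∑ a, ∑ d, ∑ b, f a b c d :=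
          Finset.sum_congr rfl fun c _ => Finset.sum_comm
      _ = ∑ c, ∑ a, ∑ b, ∑ d, f a b c d :=
          Finset.sum_congr rfl fun c _ => Finset.sum_congr rfl fun a _ => Finset.sum_comm
      _ = ∑ a, ∑ c, ∑ b, ∑ d, f a b c d := Finset.sum_comm
      _ = _ := Finset.sum_congr rfl fun a _ => Finset.sum_comm
  exact this _

/-- A `C²` matrix function which near `z` is a Kähler metric: positive definite Hermitian, with
closed fundamental form. -/
structure IsKahlerNear (G : Cn m → Matrix (Fin m) (Fin m) ℂ) (z : Cn m) : Prop where
  contDiff : MatContDiffAt 2 G z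
  posDef : ∀ᶠ w in nhds z, (G w).PosDef
  closed : ∀ᶠ w in nhds z, ∀ a b c,
    wd (-1) (basisVec c) (fun y => G y a b) w = wd (-1) (basisVec a) (fun y => G y c b) w

theorem conjTranspose_wdM {E : Type*} [NormedAddCommGroup E] [NormedSpace ℂ E] {n : Type*}
    {G : E → Matrix n n ℂ} {z : E} (hG : ∀ᶠ w in nhds z, (G w).IsHermitian) (v : E) :
    (wdM (-1) v G z)ᴴ = wdM 1 v G z := by
  ext i j
  have h1 : (fun w => G w i j) =ᶠ[nhds z] fun w => (starRingEnd ℂ) (G w j i) := by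
    filter_upwards [hG] with w hw
    exact (hw.apply i j).symm
  simp only [conjTranspose_apply, wdM, of_apply]
  rw [wd_congr h1, wd_conj (by simp)]
  rfl

namespace IsKahlerNear

variable {G : Cn m → Matrix (Fin m) (Fin m) ℂ}

theorem eventually (h : IsKahlerNear G z) : ∀ᶠ w in nhds z, IsKahlerNear G w := by
  filter_upwards [h.contDiff.eventually (by simp), h.posDef.eventually_nhds,
    h.closed.eventually_nhds] with w h1 h2 h3
  exact ⟨h1, h2, h3⟩

theorem isHermitian (h : IsKahlerNear G z) : ∀ᶠ w in nhds z, (G w).IsHermitian :=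
  h.posDef.mono fun _ hw => hw.1

theorem det_ne (h : IsKahlerNear G z) : (G z).det ≠ 0 :=
  h.posDef.self_of_nhds.det_pos.ne'

theorem closed_conj (h : IsKahlerNear G z) (a b d : Fin m) :
    wd 1 (basisVec d) (fun y => G y a b) z = wd 1 (basisVec b) (fun y => G y a d) z := by
  have h1 := congrFun (congrFun (conjTranspose_wdM h.isHermitian (basisVec d)) a) b
  have h2 := congrFun (congrFun (conjTranspose_wdM h.isHermitian (basisVec b)) a) d
  simp only [conjTranspose_apply, wdM, of_apply] at h1 h2
  rw [← h1, ← h2, h.closed.self_of_nhds b a d]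

/-- The symmetry `R_{ab̄cd̄} = R_{cd̄ab̄}` of the curvature of a Kähler metric. -/
theorem chernCurv_symm (h : IsKahlerNear G z) (a b c d : Fin m) :
    chernCurv G z (basisVec a) (basisVec b) c d
      = chernCurv G z (basisVec c) (basisVec d) a b := by
  have hc : wd (-1) (basisVec a) (wd 1 (basisVec b) fun w => G w c d) z
      = wd (-1) (basisVec c) (wd 1 (basisVec d) fun w => G w a b) z := by
    have e1 : (wd 1 (basisVec b) fun w => G w c d)
        =ᶠ[nhds z] wd 1 (basisVec d) fun w => G w c b := by
      filter_upwards [h.eventually] with w hw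
      exact hw.closed_conj c d b
    have e2 : (wd (-1) (basisVec a) fun w => G w c b)
        =ᶠ[nhds z] wd (-1) (basisVec c) fun w => G w a b := by
      filter_upwards [h.closed] with w hw
      exact hw c b a
    rw [wd_congr e1, wd_comm (h.contDiff c b), wd_congr e2, ← wd_comm (h.contDiff a b)]
  -- a row of `∂_a G` is a row of `∂_c G`, by closedness
  have e1 : wdM (-1) (basisVec a) G z c = wdM (-1) (basisVec c) G z a :=
    funext fun q => h.closed.self_of_nhds c q a
  have e2 : ∀ p, wdM 1 (basisVec b) G z p d = wdM 1 (basisVec d) G z p b :=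
    fun p => h.closed_conj p d b
  simp only [chernCurv, Matrix.add_apply, Matrix.neg_apply, Matrix.mul_apply, e1, e2]
  congr 2

theorem bisect_symm (h : IsKahlerNear G z) (u v : Fin m → ℂ) :
    bisect G z u v = bisect G z v u := by
  rw [bisect_eq h.contDiff, bisect]
  simp only [sesq, chernCurv_vec h.contDiff, Finset.sum_mul]
  refine Finset.sum_congr rfl fun a _ => Finset.sum_congr rfl fun b _ =>
    Finset.sum_congr rfl fun c _ => Finset.sum_congr rfl fun d _ => ?_
  rw [h.chernCurv_symm a b c d]
  ring

/-- Adding a complex Hessian preserves closedness. -/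
theorem add_complexHessian (h : IsKahlerNear G z) {φ : Cn m → ℂ} (hφ : ContDiffAt ℝ 4 φ z)
    (hpos : ∀ᶠ w in nhds z, (G w + complexHessian φ w).PosDef) :
    IsKahlerNear (fun w => G w + complexHessian φ w) z := by
  have hH : MatContDiffAt 2 (complexHessian φ) z := fun a b => by
    simp only [complexHessian_apply]
    exact contDiffAt_wd (n := 3) (contDiffAt_wd (n := 4) hφ (by norm_num)) (by norm_num)
  refine ⟨h.contDiff.add hH, hpos, ?_⟩
  filter_upwards [h.closed, h.contDiff.eventually (by simp), hH.eventually (by simp),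
    hφ.eventually (by simp)] with w h1 h2 h3 h4 a b c
  simp only [Matrix.add_apply]
  rw [wd_add ((h2 a b).differentiableAt (by norm_num)) ((h3 a b).differentiableAt (by norm_num)),
    wd_add ((h2 c b).differentiableAt (by norm_num)) ((h3 c b).differentiableAt (by norm_num)),
    h1 a b c]
  simp only [complexHessian_apply]
  rw [wd_comm (contDiffAt_wd (n := 4) h4 (by norm_num))]

end IsKahlerNear

end Coordinates

/-! ### The maximum principle -/

section MaximumPrinciple

variable {E : Type*} [NormedAddCommGroup E] [NormedSpace ℂ E] {v z : E}

theorem contDiffAt_ofReal {n : ℕ∞ω} {h : E → ℝ} (hh : ContDiffAt ℝ n h z) :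
    ContDiffAt ℝ n (fun w => (h w : ℂ)) z :=
  Complex.ofRealCLM.contDiff.contDiffAt.comp z hh

/-- The second derivative test for `log σ - cψ`, stated for its exponential `σe^{-cψ}`. -/
theorem wd_wd_le_of_isLocalMax_mul_exp {σ ψ : E → ℝ} {c : ℝ} (hσ : ContDiffAt ℝ 2 σ z)
    (hψ : ContDiffAt ℝ 2 ψ z) (hpos : 0 < σ z)
    (hmax : IsLocalMax (fun w => σ w * Real.exp (-c * ψ w)) z) :
    (wd (-1) v (wd 1 v fun w => (σ w : ℂ)) z).re
      ≤ ‖wd (-1) v (fun w => (σ w : ℂ)) z‖ ^ 2 / σ z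
        + c * σ z * (wd (-1) v (wd 1 v fun w => (ψ w : ℂ)) z).re := by
  have hexp : ContDiffAt ℝ 2 (fun w => Real.exp (-c * ψ w)) z :=
    (contDiffAt_const.mul hψ).exp
  have hh : ContDiffAt ℝ 2 (fun w => σ w * Real.exp (-c * ψ w)) z := hσ.mul hexp
  have hσc := contDiffAt_ofReal hσ
  have hψc := contDiffAt_ofReal hψ
  have h2 := wd_wd_nonpos_of_isLocalMax hh hmax v
  have h1 : wd 1 v (fun w => ((σ w * Real.exp (-c * ψ w) : ℝ) : ℂ)) z = 0 :=
    wd_eq_zero_of_isLocalMax (hh.differentiableAt (by norm_num)) hmax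
  set e : E → ℂ := fun w => Complex.exp (-c * ψ w) with he
  have hec : ContDiffAt ℝ 2 e z := (contDiffAt_const.mul hψc).cexp
  set q : E → ℂ := fun w => wd 1 v (fun w => (σ w : ℂ)) w
    - (c * σ w) * wd 1 v (fun w => (ψ w : ℂ)) w with hq
  have near : (wd 1 v fun w => ((σ w * Real.exp (-c * ψ w) : ℝ) : ℂ)) =ᶠ[nhds z]
      fun w => e w * q w := by
    filter_upwards [hσc.eventually (by simp), hψc.eventually (by simp)] with w k1 k2
    have d1 := k1.differentiableAt (n := 2) (by norm_num)
    have d2 := k2.differentiableAt (n := 2) (by norm_num)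
    have d3 : HasFDerivAt e (e w • ((-c : ℂ) • fderiv ℝ (fun w => (ψ w : ℂ)) w)) w :=
      (d2.hasFDerivAt.const_mul (-c : ℂ)).cexp
    have k3 : (fun w => ((σ w * Real.exp (-c * ψ w) : ℝ) : ℂ)) = fun w => (σ w : ℂ) * e w := by
      funext y
      simp [he]
    have k4 : wd 1 v e w = -c * e w * wd 1 v (fun w => (ψ w : ℂ)) w := by
      simp only [wd, d3.fderiv, smul_apply, smul_eq_mul]
      ring
    rw [k3, wd_mul d1 d3.differentiableAt, k4, hq]
    ring
  have he0 : e z ≠ 0 := Complex.exp_ne_zero _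
  have hq0 : q z = 0 := by
    rw [near.self_of_nhds] at h1
    exact (mul_eq_zero.1 h1).resolve_left he0
  have d1 : DifferentiableAt ℝ (fun w => (σ w : ℂ)) z := hσc.differentiableAt (by norm_num)
  have d2 : DifferentiableAt ℝ (wd 1 v fun w => (σ w : ℂ)) z :=
    (contDiffAt_wd (k := 1) hσc (by norm_num)).differentiableAt (by norm_num)
  have d3 : DifferentiableAt ℝ (wd 1 v fun w => (ψ w : ℂ)) z :=
    (contDiffAt_wd (k := 1) hψc (by norm_num)).differentiableAt (by norm_num)
  have d4 : DifferentiableAt ℝ (fun w => (c * σ w : ℂ)) z := d1.const_mul _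
  have d5 : DifferentiableAt ℝ q z := d2.sub (d4.mul d3)
  rw [wd_congr near, wd_mul (hec.differentiableAt (by norm_num)) d5, hq0, mul_zero, zero_add, hq,
    wd_sub d2 (d4.fun_mul d3), wd_mul d4 d3, wd_mul (differentiableAt_const _) d1, wd_const] at h2
  have hconj : wd 1 v (fun w => (σ w : ℂ)) z
      = (starRingEnd ℂ) (wd (-1) v (fun w => (σ w : ℂ)) z) := by
    rw [← wd_conj (by simp)]
    simp
  have hσ0 : (σ z : ℂ) ≠ 0 := by exact_mod_cast hpos.ne'
  -- the vanishing first derivative of `log σ - cψ`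
  have hgrad : wd 1 v (fun w => (σ w : ℂ)) z = c * σ z * wd 1 v (fun w => (ψ w : ℂ)) z :=
    sub_eq_zero.1 hq0
  have hsq : c * wd (-1) v (fun w => (σ w : ℂ)) z * wd 1 v (fun w => (ψ w : ℂ)) z
      = ((‖wd (-1) v (fun w => (σ w : ℂ)) z‖ ^ 2 / σ z : ℝ) : ℂ) := by
    push_cast
    rw [← Complex.mul_conj', ← hconj, hgrad]
    field_simp
  have hreal : e z = (Real.exp (-c * ψ z) : ℝ) := by simp [he]
  rw [hreal, Complex.re_ofReal_mul] at h2
  have h3 := nonpos_of_mul_nonpos_right h2 (Real.exp_pos _)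
  have h4 : (wd (-1) v (wd 1 v fun w => (σ w : ℂ)) z
      - ((0 * (σ z : ℂ) + c * wd (-1) v (fun w => (σ w : ℂ)) z) * wd 1 v (fun w => (ψ w : ℂ)) z
        + c * σ z * wd (-1) v (wd 1 v fun w => (ψ w : ℂ)) z))
      = wd (-1) v (wd 1 v fun w => (σ w : ℂ)) z
        - ((‖wd (-1) v (fun w => (σ w : ℂ)) z‖ ^ 2 / σ z : ℝ) : ℂ)
        - ((c * σ z : ℝ) : ℂ) * wd (-1) v (wd 1 v fun w => (ψ w : ℂ)) z := by
    rw [← hsq]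
    push_cast
    ring
  rw [h4, Complex.sub_re, Complex.sub_re, Complex.ofReal_re, Complex.re_ofReal_mul] at h3
  linarith

end MaximumPrinciple

section LocalEstimate

open Matrix

variable {m : ℕ} {z : Cn m}

theorem trace_inv_mul_eq_sum {n : Type*} [Fintype n] [DecidableEq n] {A B W : Matrix n n ℂ}
    {d : n → ℝ} (h : Wᴴ * A * W = 1) (hB : Wᴴ * B * W = diagonal fun i => (d i : ℂ)) :
    (A⁻¹ * B).trace = ((∑ i, d i : ℝ) : ℂ) := by
  rw [inv_eq_of_frame h, trace_frame]
  simp only [sesq_frameVec, hB, diagonal_apply_eq]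
  push_cast
  rfl

theorem trace_inv_mul_real {n : Type*} [Fintype n] [DecidableEq n] {A B : Matrix n n ℂ}
    (hA : A.PosDef) (hB : B.PosDef) : (A⁻¹ * B).trace = (((A⁻¹ * B).trace).re : ℂ) := by
  obtain ⟨W, d, hW, -, hWB⟩ := exists_simultaneous_diagonalization hA hB
  rw [trace_inv_mul_eq_sum hW hWB, Complex.ofReal_re]

theorem trace_inv_mul_pos {n : Type*} [Fintype n] [DecidableEq n] [Nonempty n]
    {A B : Matrix n n ℂ} (hA : A.PosDef) (hB : B.PosDef) : 0 < ((A⁻¹ * B).trace).re := by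
  obtain ⟨W, d, hW, hd, hWB⟩ := exists_simultaneous_diagonalization hA hB
  rw [trace_inv_mul_eq_sum hW hWB, Complex.ofReal_re]
  exact Finset.sum_pos (fun i _ => hd i) Finset.univ_nonempty

/-- If the product of the eigenvalues is at most `D`, then their sum is controlled by the sum of
their inverses. -/
theorem sum_le_of_prod_le {d : Fin m → ℝ} (hd : ∀ i, 0 < d i) {D T : ℝ} (hD : ∏ i, d i ≤ D)
    (hT : ∑ i, (d i)⁻¹ ≤ T) : ∑ i, d i ≤ m * (D * T ^ (m - 1)) := by
  have hle : ∀ i, (d i)⁻¹ ≤ T := fun i =>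
    (Finset.single_le_sum (f := fun i => (d i)⁻¹) (fun j _ => (inv_pos.2 (hd j)).le)
      (Finset.mem_univ i)).trans hT
  have h1 : ∀ i, d i ≤ D * T ^ (m - 1) := fun i => by
    have e : d i = (∏ j, d j) * ∏ j ∈ Finset.univ.erase i, (d j)⁻¹ := by
      rw [← Finset.mul_prod_erase Finset.univ d (Finset.mem_univ i), mul_assoc,
        ← Finset.prod_mul_distrib]
      simp [mul_inv_cancel₀ (hd _).ne']
    have hp : ∏ j ∈ Finset.univ.erase i, (d j)⁻¹ ≤ T ^ (m - 1) := by
      refine (Finset.prod_le_prod (fun j _ => (inv_pos.2 (hd j)).le) fun j _ => hle j).trans ?_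
      simp [Finset.card_erase_of_mem]
    have hp0 : 0 < ∏ j ∈ Finset.univ.erase i, (d j)⁻¹ :=
      Finset.prod_pos fun j _ => inv_pos.2 (hd j)
    have hq0 : 0 < ∏ j, d j := Finset.prod_pos fun j _ => hd j
    rw [e]
    exact mul_le_mul hD hp hp0.le (hq0.le.trans hD)
  calc ∑ i, d i ≤ ∑ _i : Fin m, D * T ^ (m - 1) := Finset.sum_le_sum fun i _ => h1 i
    _ = _ := by simp

/-- The inequality at a local maximum of `tr(g⁻¹g̃) e^{-cφ}` in one direction of the frame: the
gradient term of the maximum principle is absorbed by the quadratic term of the Hessian of the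
trace. -/
theorem direction_le_of_isLocalMax {G H : Cn m → Matrix (Fin m) (Fin m) ℂ} {φ : Cn m → ℝ} {c : ℝ}
    (hG : IsKahlerNear G z) (hH : IsKahlerNear H z) (hφ : ContDiffAt ℝ 2 φ z)
    (hm : 1 ≤ m)
    (hmax : IsLocalMax (fun w => ((G w)⁻¹ * H w).trace.re * Real.exp (-c * φ w)) z) (v : Cn m) :
    ((G z)⁻¹ * chernCurv G z v v * (G z)⁻¹ * H z).trace.re
      - ((G z)⁻¹ * chernCurv H z v v).trace.re
      ≤ c * ((G z)⁻¹ * H z).trace.re * (wd (-1) v (wd 1 v fun w => (φ w : ℂ)) z).re := by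
  have : Nonempty (Fin m) := ⟨⟨0, hm⟩⟩
  have hG1 : MatContDiffAt 1 G z := hG.contDiff.of_le (by norm_num)
  have hH1 : MatContDiffAt 1 H z := hH.contDiff.of_le (by norm_num)
  have hS : ContDiffAt ℝ 2 (fun w => ((G w)⁻¹ * H w).trace) z :=
    ((hG.contDiff.inv hG.det_ne).mul hH.contDiff).trace
  have hSr : ContDiffAt ℝ 2 (fun w => ((G w)⁻¹ * H w).trace.re) z :=
    Complex.reCLM.contDiff.contDiffAt.comp z hS
  have hreal : (fun w => ((((G w)⁻¹ * H w).trace.re : ℝ) : ℂ)) =ᶠ[nhds z]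
      fun w => ((G w)⁻¹ * H w).trace := by
    filter_upwards [hG.posDef, hH.posDef] with w h1 h2
    exact (trace_inv_mul_real h1 h2).symm
  have hGz := hG.posDef.self_of_nhds
  have hHz := hH.posDef.self_of_nhds
  have hpos := trace_inv_mul_pos hGz hHz
  have key := wd_wd_le_of_isLocalMax_mul_exp (v := v) hSr hφ hpos hmax
  rw [wd_congr (wd_eventuallyEq hreal), wd_congr hreal,
    wd_wd_trace_inv_mul hG.contDiff hH.contDiff hG.det_ne hH.det_ne, Complex.add_re,
    Complex.sub_re] at key
  set X := wdM (-1) v H z - wdM (-1) v G z * (G z)⁻¹ * H z with hX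
  have hXH : Xᴴ = wdM 1 v H z - H z * (G z)⁻¹ * wdM 1 v G z := by
    rw [hX, conjTranspose_sub, conjTranspose_mul, conjTranspose_mul, conjTranspose_nonsing_inv,
      conjTranspose_wdM hG.isHermitian, conjTranspose_wdM hH.isHermitian, hGz.1.eq, hHz.1.eq,
      mul_assoc]
  have hgrad : wd (-1) v (fun w => ((G w)⁻¹ * H w).trace) z = ((G z)⁻¹ * X).trace := by
    rw [wd_trace ((hG1.inv hG.det_ne).mul hH1), wdM_mul (hG1.inv hG.det_ne) hH1,
      wdM_inv hG1 hG.det_ne, hX]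
    congr 1
    noncomm_ring
  obtain ⟨W, d, hW, hd, hWB⟩ := exists_simultaneous_diagonalization hGz hHz
  have hCS := norm_trace_sq_le hW hd hWB X
  have hsum : ((G z)⁻¹ * H z).trace.re = ∑ i, d i := by
    rw [trace_inv_mul_eq_sum hW hWB, Complex.ofReal_re]
  rw [hgrad, ← hXH] at key
  have h1 : ‖((G z)⁻¹ * X).trace‖ ^ 2 / ((G z)⁻¹ * H z).trace.re
      ≤ ((G z)⁻¹ * X * (H z)⁻¹ * Xᴴ).trace.re := by
    rw [div_le_iff₀ hpos, mul_comm, hsum]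
    exact hCS
  linarith

/-! ### The estimate at a local maximum -/

/-- The weighted sum over the frame of the inequalities `direction_le_of_isLocalMax`, rearranged:
at a local maximum of `tr(g⁻¹g̃) e^{-cφ}` where the trace is at least `1`, the constant
`c = 2|K| + 1` makes the curvature terms absorbable, and the trace of `g̃⁻¹g` is bounded. -/
theorem sum_inv_le_of_isLocalMax {G : Cn m → Matrix (Fin m) (Fin m) ℂ} {φ f : Cn m → ℝ}
    {K F₁ : ℝ} (hm : 1 ≤ m) (hG : IsKahlerNear G z)
    (hH : IsKahlerNear (fun w => G w + complexHessian (fun y => (φ y : ℂ)) w) z)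
    (hφ : ContDiffAt ℝ 2 φ z) (hf : ContDiffAt ℝ 2 f z)
    (heq : ∀ᶠ w in nhds z, (G w + complexHessian (fun y => (φ y : ℂ)) w).det
      = Complex.exp (f w) * (G w).det)
    (hK : ∀ u v, sesq (G z) u u = 1 → sesq (G z) v v = 1 → ‖bisect G z u v‖ ≤ K)
    (hF₁ : -((G z)⁻¹ * complexHessian (fun y => (f y : ℂ)) z).trace.re ≤ F₁)
    (hmax : IsLocalMax (fun w => ((G w)⁻¹ * (G w + complexHessian (fun y => (φ y : ℂ)) w)).trace.re
      * Real.exp (-(2 * |K| + 1) * φ w)) z)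
    {W : Matrix (Fin m) (Fin m) ℂ} {d : Fin m → ℝ} (hW : Wᴴ * G z * W = 1) (hd : ∀ i, 0 < d i)
    (hWB : Wᴴ * (G z + complexHessian (fun y => (φ y : ℂ)) z) * W = diagonal fun i => (d i : ℂ))
    (hS : 1 ≤ ∑ i, d i) :
    ∑ i, (d i)⁻¹ ≤ |F₁| + (2 * |K| + 1) * m := by
  set H : Cn m → Matrix (Fin m) (Fin m) ℂ :=
    fun w => G w + complexHessian (fun y => (φ y : ℂ)) w with hHdef
  set c : ℝ := 2 * |K| + 1 with hc
  have hWB' : Wᴴ * H z * W = diagonal fun i => (d i : ℂ) := hWB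
  have hunit : ∀ i, sesq (G z) (frameVec W i) (frameVec W i) = 1 := fun i => by
    rw [sesq_frameVec, hW, one_apply_eq]
  have hP := inv_eq_of_frame hW
  have hQ := inv_eq_of_frame_diagonal hW hd hWB'
  have hSval : ((G z)⁻¹ * H z).trace.re = ∑ i, d i := by
    rw [trace_inv_mul_eq_sum hW hWB', Complex.ofReal_re]
  set S := ∑ i, d i with hSdef
  set T := ∑ i, (d i)⁻¹ with hTdef
  have hKG : ∀ i j, |(bisect G z (frameVec W i) (frameVec W j)).re| ≤ K := fun i j =>
    (Complex.abs_re_le_norm _).trans (hK _ _ (hunit i) (hunit j))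
  have hK0 : 0 ≤ K := (abs_nonneg _).trans (hKG ⟨0, hm⟩ ⟨0, hm⟩)
  have hKabs : |K| = K := abs_of_nonneg hK0
  -- the curvature of `g` in the direction `i`
  have hcurv : ∀ i, -(K * S) ≤
      ((G z)⁻¹ * chernCurv G z (vec (frameVec W i)) (vec (frameVec W i))
        * (G z)⁻¹ * H z).trace.re := by
    intro i
    have e1 : (G z)⁻¹ * H z * (G z)⁻¹ = W * (diagonal fun i => (d i : ℂ)) * Wᴴ := by
      rw [hP, ← hWB']; noncomm_ring
    have e2 : ((G z)⁻¹ * chernCurv G z (vec (frameVec W i)) (vec (frameVec W i)) * (G z)⁻¹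
        * H z).trace = ∑ j, (d j : ℂ) * bisect G z (frameVec W i) (frameVec W j) := by
      have : (G z)⁻¹ * chernCurv G z (vec (frameVec W i)) (vec (frameVec W i)) * (G z)⁻¹ * H z
        = ((G z)⁻¹ * chernCurv G z (vec (frameVec W i)) (vec (frameVec W i)))
          * ((G z)⁻¹ * H z) := by
        noncomm_ring
      rw [this, trace_mul_comm, ← mul_assoc, e1, trace_frame_diagonal]
      rfl
    rw [e2, Complex.re_sum, hSdef, Finset.mul_sum, ← Finset.sum_neg_distrib]
    refine Finset.sum_le_sum fun j _ => ?_
    rw [Complex.re_ofReal_mul]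
    nlinarith [(abs_le.1 (hKG i j)).1, hd j]
  -- the complex Hessian of `φ` in the direction `i`
  have hhess : ∀ i, (wd (-1) (vec (frameVec W i))
      (wd 1 (vec (frameVec W i)) fun w => (φ w : ℂ)) z).re = d i - 1 := by
    intro i
    rw [wd_wd_eq_sesq (contDiffAt_ofReal hφ), sesq_frameVec]
    have : complexHessian (fun w => (φ w : ℂ)) z = H z - G z := by simp [hHdef]
    rw [this, mul_sub, sub_mul, hWB', hW]
    simp
  have hricci : ∀ i, ((G z)⁻¹ * chernCurv H z (vec (frameVec W i)) (vec (frameVec W i))).trace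
      = ∑ j, bisect H z (frameVec W i) (frameVec W j) := fun i => by
    rw [hP, trace_frame]
    rfl
  -- the Ricci curvature of `g̃` comes from the Calabi–Yau equation
  have hricci' : ∀ j, ∑ i, ((d i)⁻¹ : ℂ) * bisect H z (frameVec W i) (frameVec W j)
      = ∑ i, bisect G z (frameVec W j) (frameVec W i)
        - sesq (complexHessian (fun y => (f y : ℂ)) z) (frameVec W j) (frameVec W j) := by
    intro j
    have e1 := wd_wd_of_det_eq (v := vec (frameVec W j)) (v' := vec (frameVec W j)) hG.contDiff
      hH.contDiff hG.det_ne hH.det_ne (contDiffAt_ofReal hf) heq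
    rw [hQ, hP, trace_frame, trace_frame_diagonal, wd_wd_eq_sesq (contDiffAt_ofReal hf)] at e1
    refine Eq.trans ?_ e1
    exact Finset.sum_congr rfl fun i _ => by rw [hH.bisect_symm]; rfl
  have hscal : ∑ i, (d i)⁻¹ * ((G z)⁻¹ * chernCurv H z (vec (frameVec W i))
      (vec (frameVec W i))).trace.re ≤ K * m * m + F₁ := by
    have e1 : ((∑ i, (d i)⁻¹ * ((G z)⁻¹ * chernCurv H z (vec (frameVec W i))
        (vec (frameVec W i))).trace.re : ℝ))
        = (∑ j, ∑ i, bisect G z (frameVec W j) (frameVec W i)).re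
          - ((G z)⁻¹ * complexHessian (fun y => (f y : ℂ)) z).trace.re := by
      rw [hP, trace_frame, ← Complex.sub_re, ← Finset.sum_sub_distrib]
      rw [Finset.sum_congr rfl fun j _ => (hricci' j).symm, Finset.sum_comm, Complex.re_sum]
      refine Finset.sum_congr rfl fun i _ => ?_
      rw [← Finset.mul_sum, ← hricci i, ← hP, ← Complex.ofReal_inv, Complex.re_ofReal_mul]
    have e2 : (∑ j, ∑ i, bisect G z (frameVec W j) (frameVec W i)).re ≤ K * m * m := by
      simp only [Complex.re_sum]
      calc ∑ j, ∑ i, (bisect G z (frameVec W j) (frameVec W i)).re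
          ≤ ∑ _j : Fin m, ∑ _i : Fin m, K := Finset.sum_le_sum fun j _ =>
            Finset.sum_le_sum fun i _ => (abs_le.1 (hKG j i)).2
        _ = K * m * m := by simp; ring
    rw [e1]
    linarith
  -- the inequality in the direction `i`, with the weight `(d i)⁻¹`
  have hdir : ∀ i, (d i)⁻¹ * (-(K * S)) - (d i)⁻¹ * ((G z)⁻¹ * chernCurv H z
      (vec (frameVec W i)) (vec (frameVec W i))).trace.re ≤ c * S * (1 - (d i)⁻¹) := by
    intro i
    have h1 := direction_le_of_isLocalMax hG hH hφ hm hmax (vec (frameVec W i))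
    rw [hhess i, hSval] at h1
    have h2 := hcurv i
    have h3 : -(K * S) - ((G z)⁻¹ * chernCurv H z (vec (frameVec W i))
      (vec (frameVec W i))).trace.re ≤ c * S * (d i - 1) := by linarith
    have h4 := mul_le_mul_of_nonneg_left h3 (inv_pos.2 (hd i)).le
    have h5 : (d i)⁻¹ * (c * S * (d i - 1)) = c * S * (1 - (d i)⁻¹) := by
      have := (hd i).ne'
      field_simp
    rw [h5] at h4
    linarith
  have htotal : T * (-(K * S)) - (K * m * m + F₁) ≤ c * S * (m - T) := by
    have h1 := Finset.sum_le_sum fun i (_ : i ∈ Finset.univ) => hdir i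
    rw [Finset.sum_sub_distrib, ← Finset.sum_mul, ← Finset.mul_sum, Finset.sum_sub_distrib] at h1
    simp only [Finset.sum_const, Finset.card_univ, Fintype.card_fin, nsmul_eq_mul, mul_one] at h1
    linarith
  -- by Cauchy–Schwarz; it absorbs the scalar curvature of `g` into `K * S * T`
  have hST : (m : ℝ) * m ≤ S * T := by
    have := Finset.sum_sq_le_sum_mul_sum_of_sq_le_mul Finset.univ (r := fun _ : Fin m => (1 : ℝ))
      (f := d) (g := fun i => (d i)⁻¹) (fun i _ => (hd i).le) (fun i _ => (inv_pos.2 (hd i)).le)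
      fun i _ => by rw [mul_inv_cancel₀ (hd i).ne', one_pow]
    simpa [sq] using this
  have h6 : S * T ≤ S * (|F₁| + c * m) := by
    have h7 : K * (m * m) ≤ K * (S * T) := mul_le_mul_of_nonneg_left hST hK0
    have h8 : F₁ ≤ S * |F₁| := (le_abs_self _).trans (le_mul_of_one_le_left (abs_nonneg _) hS)
    rw [hc, hKabs] at htotal ⊢
    linarith
  exact le_of_mul_le_mul_left h6 (by linarith)

/-- The pointwise bound for the trace at a local maximum of `tr(g⁻¹g̃) e^{-cφ}`. -/
theorem trace_le_of_isLocalMax {G : Cn m → Matrix (Fin m) (Fin m) ℂ} {φ f : Cn m → ℝ}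
    {K F₀ F₁ : ℝ} (hm : 1 ≤ m) (hG : IsKahlerNear G z)
    (hH : IsKahlerNear (fun w => G w + complexHessian (fun y => (φ y : ℂ)) w) z)
    (hφ : ContDiffAt ℝ 2 φ z) (hf : ContDiffAt ℝ 2 f z)
    (heq : ∀ᶠ w in nhds z, (G w + complexHessian (fun y => (φ y : ℂ)) w).det
      = Complex.exp (f w) * (G w).det)
    (hK : ∀ u v, sesq (G z) u u = 1 → sesq (G z) v v = 1 → ‖bisect G z u v‖ ≤ K)
    (hF₀ : f z ≤ F₀)
    (hF₁ : -((G z)⁻¹ * complexHessian (fun y => (f y : ℂ)) z).trace.re ≤ F₁)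
    (hmax : IsLocalMax (fun w => ((G w)⁻¹ * (G w + complexHessian (fun y => (φ y : ℂ)) w)).trace.re
      * Real.exp (-(2 * |K| + 1) * φ w)) z) :
    ((G z)⁻¹ * (G z + complexHessian (fun y => (φ y : ℂ)) z)).trace.re
      ≤ max 1 (m * (Real.exp F₀ * (|F₁| + (2 * |K| + 1) * m) ^ (m - 1))) := by
  obtain ⟨W, d, hW, hd, hWB⟩ :=
    exists_simultaneous_diagonalization hG.posDef.self_of_nhds hH.posDef.self_of_nhds
  rw [trace_inv_mul_eq_sum hW hWB, Complex.ofReal_re]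
  rcases le_total (∑ i, d i) 1 with h | h
  · exact h.trans (le_max_left _ _)
  refine le_trans (sum_le_of_prod_le hd (D := Real.exp F₀) ?_
    (sum_inv_le_of_isLocalMax hm hG hH hφ hf heq hK hF₁ hmax hW hd hWB h)) (le_max_right _ _)
  have h1 := congrArg det hW
  have h2 := congrArg det hWB
  rw [det_mul, det_mul, det_one] at h1
  rw [det_mul, det_mul, heq.self_of_nhds, det_diagonal] at h2
  have h3 : ((∏ i, d i : ℝ) : ℂ) = (Real.exp (f z) : ℝ) := by
    push_cast
    rw [← h2]
    linear_combination Complex.exp (f z) * h1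
  rw [Complex.ofReal_injective h3]
  exact Real.exp_le_exp.2 hF₀

end LocalEstimate

/-! ### Holomorphic changes of coordinates -/

section ChangeOfCoordinates

open Matrix

variable {E : Type*} [NormedAddCommGroup E] [NormedSpace ℂ E]
variable {F : Type*} [NormedAddCommGroup F] [NormedSpace ℂ F] {m : ℕ}

theorem eventually_differentiableAt {τ : F → E} {z : F} (hτ : ContDiffAt ℂ ω τ z) :
    ∀ᶠ w in nhds z, DifferentiableAt ℂ τ w :=
  ((hτ.of_le (m := 1) (by simp)).eventually (by simp)).mono fun _ hw =>
    hw.differentiableAt (by norm_num)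

theorem contDiffAt_comp_holomorphic {τ : F → E} {z : F} {u : E → ℂ} {n : ℕ∞ω}
    (hu : ContDiffAt ℝ n u (τ z)) (hτ : ContDiffAt ℂ ω τ z) :
    ContDiffAt ℝ n (fun w => u (τ w)) z :=
  hu.comp z ((hτ.restrict_scalars ℝ).of_le le_top)

/-- The complex Hessian is invariant under holomorphic maps. The direction on the right is frozen
at `z`: its variation does not enter because the derivative of a holomorphic map is holomorphic. -/
theorem wd_wd_comp {τ : F → Cn m} {z v v' : F} {u : Cn m → ℂ} (hu : ContDiffAt ℝ 2 u (τ z))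
    (hτ : ContDiffAt ℂ ω τ z) :
    wd (-1) v (wd 1 v' fun w => u (τ w)) z
      = wd (-1) (fderiv ℂ τ z v) (wd 1 (fderiv ℂ τ z v') u) (τ z) := by
  have hcont : Filter.Tendsto τ (nhds z) (nhds (τ z)) := hτ.continuousAt
  have hvec : ∀ x : Cn m, x = vec fun c => x c := fun x => by
    ext b
    simp [vec, basisVec, Pi.single_apply]
  have hcomp : ∀ b, DifferentiableAt ℂ (fun w => fderiv ℂ τ w v' b) z := fun b => by
    have h1 : DifferentiableAt ℂ (fun w => fderiv ℂ τ w v') z :=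
      ((hτ.fderiv_right (m := 1) (by simp)).differentiableAt (by norm_num)).clm_apply
        (differentiableAt_const v')
    exact (EuclideanSpace.proj (𝕜 := ℂ) b).differentiableAt.comp z h1
  have hconj : ∀ b, wd (-1) v (fun w => (starRingEnd ℂ) (fderiv ℂ τ w v' b)) z = 0 := fun b => by
    rw [wd_conj (by simp), neg_neg, wd_of_differentiableAt (hcomp b), map_zero]
  have near : (wd 1 v' fun w => u (τ w)) =ᶠ[nhds z] fun w =>
      ∑ b, (starRingEnd ℂ) (fderiv ℂ τ w v' b) * wd 1 (basisVec b) u (τ w) := by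
    filter_upwards [hcont.eventually (hu.eventually (by simp)),
      eventually_differentiableAt hτ] with w h1 h2
    rw [wd_comp (h1.differentiableAt (by norm_num)) h2, ← wd_vec_conj, ← hvec]
  have hd : ∀ b, DifferentiableAt ℝ (wd 1 (basisVec b) u) (τ z) := fun b =>
    (contDiffAt_wd (k := 1) hu (by norm_num)).differentiableAt (by norm_num)
  have hτd : DifferentiableAt ℂ τ z := hτ.differentiableAt (by simp)
  have hd' : ∀ b, DifferentiableAt ℝ (fun w => wd 1 (basisVec b) u (τ w)) z := fun b =>
    (hd b).comp z (hτd.restrictScalars ℝ)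
  have hd2 : ∀ b, DifferentiableAt ℝ (fun w => (starRingEnd ℂ) (fderiv ℂ τ w v' b)) z := fun b =>
    Complex.conjCLE.differentiableAt.comp z ((hcomp b).restrictScalars ℝ)
  have hR : (wd 1 (fderiv ℂ τ z v') u)
      = fun y => ∑ b, (starRingEnd ℂ) (fderiv ℂ τ z v' b) * wd 1 (basisVec b) u y := by
    funext y
    conv_lhs => rw [hvec (fderiv ℂ τ z v'), wd_vec_conj]
  rw [wd_congr near, hR, wd_sum _ fun b _ => (hd2 b).fun_mul (hd' b),
    wd_sum _ fun b _ => (hd b).const_mul _]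
  refine Finset.sum_congr rfl fun b _ => ?_
  rw [wd_mul (hd2 b) (hd' b), hconj, wd_comp (hd b) hτd,
    wd_mul (differentiableAt_const _) (hd b), wd_const]

theorem chernCurv_comp {n : Type*} [Fintype n] [DecidableEq n] {τ : F → Cn m} {z v v' : F}
    {G : Cn m → Matrix n n ℂ} (hG : MatContDiffAt 2 G (τ z)) (hτ : ContDiffAt ℂ ω τ z) :
    chernCurv (fun w => G (τ w)) z v v'
      = chernCurv G (τ z) (fderiv ℂ τ z v) (fderiv ℂ τ z v') := by
  have h1 : wdM (-1) v (wdM 1 v' fun w => G (τ w)) z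
      = wdM (-1) (fderiv ℂ τ z v) (wdM 1 (fderiv ℂ τ z v') G) (τ z) := by
    ext i j
    exact wd_wd_comp (u := fun y => G y i j) (hG i j) hτ
  have h2 : ∀ s v, wdM s v (fun w => G (τ w)) z = wdM s (fderiv ℂ τ z v) G (τ z) := fun s v => by
    ext i j
    have d1 : DifferentiableAt ℝ (fun y => G y i j) (τ z) :=
      (hG i j).differentiableAt (by norm_num)
    have d2 : DifferentiableAt ℂ τ z := hτ.differentiableAt (by simp)
    exact wd_comp (u := fun y => G y i j) d1 d2
  simp only [chernCurv, h1, h2]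

/-- The curvature of the Chern connection is a tensor: it is conjugated by a holomorphic change of
frame. -/
theorem chernCurv_gauge {n : Type*} [Fintype n] [DecidableEq n] {z v v' : E}
    {A G B : E → Matrix n n ℂ} (hA : MatContDiffAt 2 A z) (hG : MatContDiffAt 2 G z)
    (hB : MatContDiffAt 2 B z) (hA0 : (A z).det ≠ 0) (hB0 : (B z).det ≠ 0)
    (hAh : ∀ᶠ w in nhds z, wdM 1 v' A w = 0) (hBh : ∀ᶠ w in nhds z, wdM (-1) v B w = 0)
    (hG0 : (G z).det ≠ 0) :
    chernCurv (fun w => A w * G w * B w) z v v' = A z * chernCurv G z v v' * B z := by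
  have hA1 : MatContDiffAt 1 A z := hA.of_le (by norm_num)
  have hB1 : MatContDiffAt 1 B z := hB.of_le (by norm_num)
  have hG1 : MatContDiffAt 1 G z := hG.of_le (by norm_num)
  have hGd : MatContDiffAt 1 (wdM 1 v' G) z := hG.wdM (by norm_num)
  have hBd : MatContDiffAt 1 (wdM 1 v' B) z := hB.wdM (by norm_num)
  have near : (wdM 1 v' fun w => A w * G w * B w) =ᶠ[nhds z]
      fun w => A w * (wdM 1 v' G w * B w + G w * wdM 1 v' B w) := by
    filter_upwards [hA1.eventually (by simp), hB1.eventually (by simp),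
      hG1.eventually (by simp), hAh] with w h1 h2 h3 h4
    rw [wdM_mul (h1.mul h3) h2, wdM_mul h1 h3, h4]
    noncomm_ring
  -- `∂` and `∂̄` commute, and `B` is antiholomorphic
  have hBB : wdM (-1) v (wdM 1 v' B) z = 0 := by
    ext i j
    have h1 : (wd (-1) v fun w => B w i j) =ᶠ[nhds z] fun _ => 0 :=
      hBh.mono fun w hw => congrFun (congrFun hw i) j
    have h2 : wd (-1) v (wd 1 v' fun w => B w i j) z = 0 := by
      rw [wd_comm (hB i j), wd_congr h1, wd_const]
    exact h2
  have hB' := hBh.self_of_nhds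
  have iA : (A z)⁻¹ * A z = 1 := nonsing_inv_mul _ (isUnit_iff_ne_zero.2 hA0)
  have iB : B z * (B z)⁻¹ = 1 := mul_nonsing_inv _ (isUnit_iff_ne_zero.2 hB0)
  have iG : G z * (G z)⁻¹ = 1 := mul_nonsing_inv _ (isUnit_iff_ne_zero.2 hG0)
  have iG' : (G z)⁻¹ * G z = 1 := nonsing_inv_mul _ (isUnit_iff_ne_zero.2 hG0)
  have hnear : wdM 1 v' (fun w => A w * G w * B w) z
      = A z * (wdM 1 v' G z * B z + G z * wdM 1 v' B z) := near.self_of_nhds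
  rw [chernCurv, hnear, wdM_congr near,
    wdM_mul hA1 ((hGd.mul hB1).add (hG1.mul hBd)), wdM_add (hGd.mul hB1) (hG1.mul hBd),
    wdM_mul hGd hB1, wdM_mul hG1 hBd, hBB, wdM_mul (hA1.mul hG1) hB1, wdM_mul hA1 hG1, hB',
    chernCurv, Matrix.mul_inv_rev, Matrix.mul_inv_rev]
  generalize wdM (-1) v (wdM 1 v' G) z = DG
  generalize wdM (-1) v G z = C
  generalize wdM 1 v' G z = C'
  generalize wdM (-1) v A z = a
  generalize wdM 1 v' B z = b
  generalize (G z)⁻¹ = P at *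
  generalize (A z)⁻¹ = A' at *
  generalize (B z)⁻¹ = B' at *
  have e : ((a * G z + A z * C) * B z + A z * G z * 0) * (B' * (P * A'))
        * (A z * (C' * B z + G z * b))
      = (a * G z + A z * C) * (B z * B') * P * (A' * A z) * (C' * B z + G z * b) := by
    noncomm_ring
  rw [e, iA, iB]
  have e2 : (a * G z + A z * C) * 1 * P * 1 * (C' * B z + G z * b)
      = a * (G z * P) * (C' * B z + G z * b) + A z * C * P * C' * B z
        + A z * C * (P * G z) * b := by noncomm_ring
  rw [e2, iG, iG']
  noncomm_ring

end ChangeOfCoordinates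

/-! ### Tensoriality and bounds of the curvature -/

open Matrix

section Jacobian

variable {m : ℕ}

/-- The Jacobian matrix `(∂τ^c/∂z^a)_{c,a}`. -/
noncomputable def jac (τ : Cn m → Cn m) (z : Cn m) : Matrix (Fin m) (Fin m) ℂ :=
  Matrix.of fun c a => fderiv ℂ τ z (basisVec a) c

theorem vec_apply (u : Fin m → ℂ) (b : Fin m) : vec u b = u b := by
  simp [vec, basisVec, Pi.single_apply]

theorem fderiv_vec (τ : Cn m → Cn m) (z : Cn m) (u : Fin m → ℂ) :
    fderiv ℂ τ z (vec u) = vec (jac τ z *ᵥ u) := by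
  ext b
  rw [vec_apply]
  simp [vec, mulVec, dotProduct, jac, mul_comm]

/-- The congruence `X ↦ Jᵀ X J̄` is the substitution of `J` into the Hermitian form. -/
theorem sesq_congruence (X J : Matrix (Fin m) (Fin m) ℂ) (u v : Fin m → ℂ) :
    sesq (Jᵀ * X * J.map (starRingEnd ℂ)) u v = sesq X (J *ᵥ u) (J *ᵥ v) := by
  simp only [sesq, Matrix.mul_apply, transpose_apply, map_apply, mulVec, dotProduct, map_sum,
    map_mul, Finset.sum_mul, Finset.mul_sum]
  have key : ∀ f : Fin m → Fin m → Fin m → Fin m → ℂ,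
      ∑ a, ∑ b, ∑ d, ∑ c, f a b c d = ∑ c, ∑ d, ∑ b, ∑ a, f a b c d := fun f => by
    calc ∑ a, ∑ b, ∑ d, ∑ c, f a b c d = ∑ a, ∑ d, ∑ b, ∑ c, f a b c d :=
          Finset.sum_congr rfl fun _ _ => Finset.sum_comm
      _ = ∑ d, ∑ a, ∑ b, ∑ c, f a b c d := Finset.sum_comm
      _ = ∑ d, ∑ a, ∑ c, ∑ b, f a b c d :=
          Finset.sum_congr rfl fun _ _ => Finset.sum_congr rfl fun _ _ => Finset.sum_comm
      _ = ∑ d, ∑ c, ∑ a, ∑ b, f a b c d := Finset.sum_congr rfl fun _ _ => Finset.sum_comm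
      _ = ∑ c, ∑ d, ∑ a, ∑ b, f a b c d := Finset.sum_comm
      _ = _ := Finset.sum_congr rfl fun _ _ => Finset.sum_congr rfl fun _ _ => Finset.sum_comm
  rw [key]
  refine Finset.sum_congr rfl fun c _ => Finset.sum_congr rfl fun d _ =>
    Finset.sum_congr rfl fun b _ => Finset.sum_congr rfl fun a _ => ?_
  ring

theorem complexHessian_comp {τ : Cn m → Cn m} {z : Cn m} {u : Cn m → ℂ}
    (hu : ContDiffAt ℝ 2 u (τ z)) (hτ : ContDiffAt ℂ ω τ z) :
    complexHessian (fun w => u (τ w)) z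
      = (jac τ z)ᵀ * complexHessian u (τ z) * (jac τ z).map (starRingEnd ℂ) := by
  ext a b
  have hb : ∀ a : Fin m, fderiv ℂ τ z (basisVec a) = vec fun c => jac τ z c a := fun a => by
    ext c
    rw [vec_apply]
    rfl
  rw [complexHessian_apply, wd_wd_comp hu hτ, hb, hb, wd_wd_vec hu, Matrix.mul_apply]
  simp only [Matrix.mul_apply, Finset.sum_mul, transpose_apply, map_apply, complexHessian_apply]
  rw [Finset.sum_comm]
  exact Finset.sum_congr rfl fun d _ => Finset.sum_congr rfl fun c _ => by ring

theorem contDiffAt_jac {τ : Cn m → Cn m} {z : Cn m} (hτ : ContDiffAt ℂ ω τ z) (c a : Fin m) :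
    ContDiffAt ℂ 2 (fun w => jac τ w c a) z := by
  have h1 : ContDiffAt ℂ 2 (fun w => fderiv ℂ τ w (basisVec a)) z :=
    (hτ.fderiv_right (m := 2) (by simp)).clm_apply contDiffAt_const
  exact (EuclideanSpace.proj (𝕜 := ℂ) c).contDiff.contDiffAt.comp z h1

/-- The bisectional curvature form is invariant under a holomorphic change of coordinates. -/
theorem bisect_comp {τ : Cn m → Cn m} {z : Cn m} {G G' : Cn m → Matrix (Fin m) (Fin m) ℂ}
    (hG : (G z).det ≠ 0) (hG' : MatContDiffAt 2 G' (τ z)) (hG0 : (G' (τ z)).det ≠ 0)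
    (hτ : ContDiffAt ℂ ω τ z)
    (h : ∀ᶠ w in nhds z, G w = (jac τ w)ᵀ * G' (τ w) * (jac τ w).map (starRingEnd ℂ))
    (u v : Fin m → ℂ) :
    bisect G z u v = bisect G' (τ z) (jac τ z *ᵥ u) (jac τ z *ᵥ v) := by
  have hJ := contDiffAt_jac hτ
  have hA : MatContDiffAt 2 (fun w => (jac τ w)ᵀ) z := fun i j => (hJ j i).restrict_scalars ℝ
  have hB : MatContDiffAt 2 (fun w => (jac τ w).map (starRingEnd ℂ)) z := fun i j =>
    Complex.conjCLE.contDiff.contDiffAt.comp z ((hJ i j).restrict_scalars ℝ)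
  have hd : ∀ᶠ w in nhds z, ∀ i j, DifferentiableAt ℂ (fun w => jac τ w i j) w := by
    simp only [Filter.eventually_all]
    exact fun i j => ((hJ i j).eventually (by simp)).mono fun w hw =>
      hw.differentiableAt (by norm_num)
  have hAh : ∀ᶠ w in nhds z, wdM 1 (vec u) (fun w => (jac τ w)ᵀ) w = 0 := by
    filter_upwards [hd] with w hw
    ext i j
    exact wd_of_differentiableAt (hw j i)
  have hBh : ∀ᶠ w in nhds z, wdM (-1) (vec u) (fun w => (jac τ w).map (starRingEnd ℂ)) w = 0 := by
    filter_upwards [hd] with w hw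
    ext i j
    have : wd (-1) (vec u) (fun w => (starRingEnd ℂ) (jac τ w i j)) w = 0 := by
      rw [wd_conj (by simp), neg_neg, wd_of_differentiableAt (hw i j), map_zero]
    exact this
  have hG'c : MatContDiffAt 2 (fun w => G' (τ w)) z := fun i j =>
    contDiffAt_comp_holomorphic (hG' i j) hτ
  have hdet := hG
  rw [h.self_of_nhds, det_mul, det_mul] at hdet
  have hA0 : ((jac τ z)ᵀ).det ≠ 0 := left_ne_zero_of_mul (left_ne_zero_of_mul hdet)
  have hB0 : ((jac τ z).map (starRingEnd ℂ)).det ≠ 0 := right_ne_zero_of_mul hdet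
  have h1 : chernCurv G z (vec u) (vec u) = chernCurv (fun w => (jac τ w)ᵀ * G' (τ w)
      * (jac τ w).map (starRingEnd ℂ)) z (vec u) (vec u) := by
    have hn : ∀ᶠ w in nhds z, wdM 1 (vec u) G w = wdM 1 (vec u) (fun w => (jac τ w)ᵀ * G' (τ w)
      * (jac τ w).map (starRingEnd ℂ)) w := h.eventually_nhds.mono fun w hw => wdM_congr hw
    rw [chernCurv, chernCurv, wdM_congr h, wdM_congr h, wdM_congr hn, h.self_of_nhds]
  rw [bisect, h1, chernCurv_gauge hA hG'c hB hA0 hB0 hAh hBh hG0, chernCurv_comp hG' hτ,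
    sesq_congruence, fderiv_vec]
  rfl

end Jacobian

section CurvatureBound

variable {m : ℕ}

/-- A unit vector has components bounded by the trace of the inverse metric: expand it in an
orthonormal frame and apply Cauchy–Schwarz. -/
theorem norm_sq_le_of_sesq_eq_one {A : Matrix (Fin m) (Fin m) ℂ} (hA : A.PosDef) {u : Fin m → ℂ}
    (hu : sesq A u u = 1) (a : Fin m) : ‖u a‖ ^ 2 ≤ (A⁻¹).trace.re := by
  obtain ⟨W, -, hW, -, -⟩ := exists_simultaneous_diagonalization hA hA
  set J : Matrix (Fin m) (Fin m) ℂ := W.map (starRingEnd ℂ) with hJ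
  have hJT : Jᵀ = Wᴴ := by
    ext i j
    rfl
  have hJc : J.map (starRingEnd ℂ) = W := by
    ext i j
    simp [hJ]
  have hJ0 : IsUnit J.det := by
    rw [← det_transpose, hJT]
    have h1 := congrArg det hW
    rw [mul_assoc, det_mul, det_one] at h1
    exact IsUnit.of_mul_eq_one _ h1
  have hη : J *ᵥ (J⁻¹ *ᵥ u) = u := by
    rw [mulVec_mulVec, mul_nonsing_inv _ hJ0, one_mulVec]
  generalize J⁻¹ *ᵥ u = η at hη
  have h1 : ∑ i, ‖η i‖ ^ 2 = 1 := by
    have h2 := sesq_congruence A J η η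
    rw [hJT, hJc, hW, hη, hu] at h2
    simp only [sesq, one_apply, ite_mul, one_mul, zero_mul, Finset.sum_ite_eq, Finset.mem_univ,
      if_true, Complex.mul_conj'] at h2
    exact_mod_cast h2
  have h3 : (A⁻¹).trace.re = ∑ b, ∑ i, ‖J b i‖ ^ 2 := by
    rw [inv_eq_of_frame hW]
    simp only [Matrix.trace, diag_apply, Matrix.mul_apply, conjTranspose_apply, Complex.re_sum]
    refine Finset.sum_congr rfl fun b _ => Finset.sum_congr rfl fun i _ => ?_
    have : W b i * star (W b i) = ((‖J b i‖ ^ 2 : ℝ) : ℂ) := by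
      have := Complex.mul_conj' (W b i)
      rw [hJ, map_apply, RCLike.norm_conj]
      exact_mod_cast this
    rw [this, Complex.ofReal_re]
  have h4 : ‖u a‖ ≤ ∑ i, ‖J a i‖ * ‖η i‖ := by
    have h5 : u a = ∑ i, J a i * η i := by rw [← hη]; rfl
    rw [h5]
    refine (norm_sum_le _ _).trans (Finset.sum_le_sum fun i _ => ?_)
    rw [norm_mul]
  calc ‖u a‖ ^ 2 ≤ (∑ i, ‖J a i‖ * ‖η i‖) ^ 2 := by gcongr
    _ ≤ (∑ i, ‖J a i‖ ^ 2) * ∑ i, ‖η i‖ ^ 2 := Finset.sum_mul_sq_le_sq_mul_sq _ _ _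
    _ = ∑ i, ‖J a i‖ ^ 2 := by rw [h1, mul_one]
    _ ≤ _ := by
      rw [h3]
      exact Finset.single_le_sum (f := fun b => ∑ i, ‖J b i‖ ^ 2)
        (fun b _ => Finset.sum_nonneg fun i _ => sq_nonneg _) (Finset.mem_univ a)

/-- A bound for the bisectional curvature which depends continuously on the metric. -/
theorem norm_bisect_le {G : Cn m → Matrix (Fin m) (Fin m) ℂ} {z : Cn m} (hG : MatContDiffAt 2 G z)
    (hpos : (G z).PosDef) {u v : Fin m → ℂ} (hu : sesq (G z) u u = 1) (hv : sesq (G z) v v = 1) :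
    ‖bisect G z u v‖ ≤ ∑ a, ∑ b, ∑ c, ∑ d,
      ‖chernCurv G z (basisVec a) (basisVec b) c d‖ * ((G z)⁻¹).trace.re ^ 2 := by
  set t := ((G z)⁻¹).trace.re
  have hprod : ∀ {x : Fin m → ℂ}, sesq (G z) x x = 1 → ∀ a b, ‖x a‖ * ‖x b‖ ≤ t := by
    intro x hx a b
    have h1 := norm_sq_le_of_sesq_eq_one hpos hx a
    have h2 := norm_sq_le_of_sesq_eq_one hpos hx b
    nlinarith [sq_nonneg (‖x a‖ - ‖x b‖)]
  rw [bisect_eq hG]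
  refine (norm_sum_le _ _).trans (Finset.sum_le_sum fun a _ => ?_)
  refine (norm_sum_le _ _).trans (Finset.sum_le_sum fun b _ => ?_)
  refine (norm_sum_le _ _).trans (Finset.sum_le_sum fun c _ => ?_)
  refine (norm_sum_le _ _).trans (Finset.sum_le_sum fun d _ => ?_)
  simp only [norm_mul, RCLike.norm_conj]
  have h1 := hprod hu a b
  have h2 := hprod hv c d
  have h3 : ‖u a‖ * ‖u b‖ * (‖v c‖ * ‖v d‖) ≤ t * t :=
    mul_le_mul h1 h2 (by positivity) ((by positivity : 0 ≤ ‖u a‖ * ‖u b‖).trans h1)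
  calc _ = ‖chernCurv G z (basisVec a) (basisVec b) c d‖
        * (‖u a‖ * ‖u b‖ * (‖v c‖ * ‖v d‖)) := by ring
    _ ≤ _ := by
      rw [sq]
      exact mul_le_mul_of_nonneg_left h3 (norm_nonneg _)

theorem exists_bisect_bound_near {G : Cn m → Matrix (Fin m) (Fin m) ℂ} {z : Cn m}
    (hG : IsKahlerNear G z) :
    ∃ K : ℝ, ∀ᶠ w in nhds z, ∀ u v, sesq (G w) u u = 1 → sesq (G w) v v = 1 →
      ‖bisect G w u v‖ ≤ K := by
  have hR : ∀ a b c d, ContinuousAt (fun w => chernCurv G w (basisVec a) (basisVec b) c d) z := by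
    intro a b c d
    have h0 : MatContDiffAt 0 G z := hG.contDiff.of_le (by norm_num)
    have h1 : ∀ s v, MatContDiffAt 0 (wdM s v G) z := fun s v =>
      hG.contDiff.wdM (by norm_num)
    have h2 : MatContDiffAt 0 (wdM (-1) (basisVec a) (wdM 1 (basisVec b) G)) z :=
      MatContDiffAt.wdM (n := 1) (hG.contDiff.wdM (by norm_num)) (by norm_num)
    have h3 := ((h1 (-1) (basisVec a)).mul (h0.inv hG.det_ne)).mul (h1 1 (basisVec b))
    exact ((h2 c d).neg.add (h3 c d)).continuousAt
  have ht : ContinuousAt (fun w => ((G w)⁻¹).trace.re) z :=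
    Complex.continuous_re.continuousAt.comp (hG.contDiff.inv hG.det_ne).trace.continuousAt
  have hB : ContinuousAt (fun w => ∑ a, ∑ b, ∑ c, ∑ d,
      ‖chernCurv G w (basisVec a) (basisVec b) c d‖ * ((G w)⁻¹).trace.re ^ 2) z :=
    tendsto_finsetSum _ fun a _ => tendsto_finsetSum _ fun b _ => tendsto_finsetSum _ fun c _ =>
      tendsto_finsetSum _ fun d _ => (hR a b c d).norm.mul (ht.pow 2)
  refine ⟨(∑ a, ∑ b, ∑ c, ∑ d,
    ‖chernCurv G z (basisVec a) (basisVec b) c d‖ * ((G z)⁻¹).trace.re ^ 2) + 1, ?_⟩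
  filter_upwards [hB.eventually_lt_const (lt_add_one _), hG.eventually] with w h1 h2 u v hu hv
  exact (norm_bisect_le h2.contDiff h2.posDef.self_of_nhds hu hv).trans h1.le

end CurvatureBound

/-! ### Kähler metrics in charts -/

theorem trace_inv_mul_congruence {n : Type*} [Fintype n] [DecidableEq n] {A B G X : Matrix n n ℂ}
    (hA : A.det ≠ 0) (hB : B.det ≠ 0) :
    ((A * G * B)⁻¹ * (A * X * B)).trace = (G⁻¹ * X).trace := by
  have iA : A⁻¹ * A = 1 := nonsing_inv_mul _ (isUnit_iff_ne_zero.2 hA)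
  have iB : B * B⁻¹ = 1 := mul_nonsing_inv _ (isUnit_iff_ne_zero.2 hB)
  rw [Matrix.mul_inv_rev, Matrix.mul_inv_rev]
  have : B⁻¹ * (G⁻¹ * A⁻¹) * (A * X * B) = B⁻¹ * (G⁻¹ * (A⁻¹ * A) * X * B) := by noncomm_ring
  rw [this, trace_mul_comm, iA, mul_one, mul_assoc, iB, mul_one]

section Charts

variable {m : ℕ} {M : Type*} [TopologicalSpace M] [ChartedSpace (Cn m) M]

theorem contDiffAt_transition [IsManifold 𝓘(ℂ, Cn m) ω M] {e e' : OpenPartialHomeomorph M (Cn m)}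
    (he : e ∈ atlas (Cn m) M) (he' : e' ∈ atlas (Cn m) M) {z : Cn m}
    (hz : z ∈ (e.symm.trans e').source) : ContDiffAt ℂ ω (e.symm.trans e') z := by
  have h1 := HasGroupoid.compatible (G := contDiffGroupoid ω 𝓘(ℂ, Cn m)) he he'
  have h2 := (contMDiffOn_of_mem_contDiffGroupoid h1).contDiffOn
  exact h2.contDiffAt ((e.symm.trans e').open_source.mem_nhds hz)

/-- Differentiability on the manifold refers to the preferred charts only; the holomorphic
transition maps carry it over to every chart of the atlas. -/
theorem contDiffAt_chart [IsManifold 𝓘(ℂ, Cn m) ω M] {φ : M → ℝ} {n : ℕ∞ω}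
    (hφ : ContMDiff 𝓘(ℝ, Cn m) 𝓘(ℝ) n φ) {e : OpenPartialHomeomorph M (Cn m)}
    (he : e ∈ atlas (Cn m) M) {z : Cn m} (hz : z ∈ e.target) :
    ContDiffAt ℝ n (fun w => φ (e.symm w)) z := by
  set x := e.symm z
  set e₀ := chartAt (Cn m) x with he₀
  have hzs : z ∈ (e.symm.trans e₀).source := by
    simp [hz, he₀, x]
  have h1 : ContDiffAt ℝ n (fun w => φ (e₀.symm w)) (e₀ x) := by
    have := (contMDiffAt_iff.1 (hφ x)).2
    simpa [Function.comp_def, contDiffWithinAt_univ, chartAt_self_eq] using this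
  have h2 : ContDiffAt ℝ n (fun w => φ (e₀.symm (e.symm.trans e₀ w))) z :=
    ContDiffAt.comp z (f := e.symm.trans e₀) h1
      (((contDiffAt_transition he (chart_mem_atlas _ x) hzs).restrict_scalars ℝ).of_le le_top)
  refine h2.congr_of_eventuallyEq ?_
  filter_upwards [(e.symm.trans e₀).open_source.mem_nhds hzs] with w hw
  rw [OpenPartialHomeomorph.trans_source] at hw
  simp only [OpenPartialHomeomorph.coe_trans, Function.comp_apply]
  rw [e₀.left_inv hw.2]

namespace KahlerMetric

variable (g : KahlerMetric m M)

theorem isKahlerNear {e : OpenPartialHomeomorph M (Cn m)} (he : e ∈ atlas (Cn m) M) {z : Cn m}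
    (hz : z ∈ e.target) : IsKahlerNear (g.coeff e) z := by
  have hn := e.open_target.mem_nhds hz
  have h2 : (2 : ℕ∞ω) ≤ ∞ := WithTop.coe_le_coe.2 (le_top (a := (2 : ℕ∞)))
  refine ⟨fun a b => ((g.smooth e he a b).contDiffAt hn).of_le h2, ?_, ?_⟩
  · filter_upwards [hn] with w hw using g.posDef e he w hw
  · filter_upwards [hn] with w hw a b c
    have := g.closed e he w hw a b c
    rwa [dz_eq_wd, dz_eq_wd] at this

theorem bisectional_eq_bisect {e : OpenPartialHomeomorph M (Cn m)} (he : e ∈ atlas (Cn m) M)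
    {z : Cn m} (hz : z ∈ e.target) (u v : Fin m → ℂ) :
    g.bisectional e z u v = bisect (g.coeff e) z u v := by
  rw [bisect_eq (g.isKahlerNear he hz).contDiff, bisectional]
  have : ∀ a b c d, g.curvature e z a b c d
      = chernCurv (g.coeff e) z (basisVec a) (basisVec b) c d := by
    intro a b c d
    simp only [curvature, dz_eq_wd, dzbar_eq_wd, chernCurv, Matrix.add_apply, Matrix.neg_apply,
      Matrix.mul_apply, Finset.sum_mul]
    congr 1
    refine Finset.sum_congr rfl fun p _ => Finset.sum_congr rfl fun q _ => ?_
    simp only [wdM, of_apply]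
    ring
  simp only [this]

variable {e e' : OpenPartialHomeomorph M (Cn m)}

theorem coeff_eq (he : e ∈ atlas (Cn m) M) (he' : e' ∈ atlas (Cn m) M) {z : Cn m}
    (hz : z ∈ (e.symm.trans e').source) :
    g.coeff e z = (jac (e.symm.trans e') z)ᵀ * g.coeff e' (e.symm.trans e' z)
      * (jac (e.symm.trans e') z).map (starRingEnd ℂ) := by
  ext a b
  rw [g.transform e he e' he' z hz a b]
  simp only [Matrix.mul_apply, Finset.sum_mul, transpose_apply, map_apply]
  rw [Finset.sum_comm]
  refine Finset.sum_congr rfl fun d _ => Finset.sum_congr rfl fun c _ => ?_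
  simp only [jac, basisVec, of_apply]
  ring

theorem complexHessian_localRep_eq [IsManifold 𝓘(ℂ, Cn m) ω M] {φ : M → ℝ}
    (hφ : ContMDiff 𝓘(ℝ, Cn m) 𝓘(ℝ) 2 φ) (he : e ∈ atlas (Cn m) M)
    (he' : e' ∈ atlas (Cn m) M) {z : Cn m} (hz : z ∈ (e.symm.trans e').source) :
    complexHessian (localRep φ e) z = (jac (e.symm.trans e') z)ᵀ
      * complexHessian (localRep φ e') (e.symm.trans e' z)
      * (jac (e.symm.trans e') z).map (starRingEnd ℂ) := by
  have hτ := contDiffAt_transition he he' hz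
  have hmem : (e.symm.trans e') z ∈ e'.target := by
    have := (e.symm.trans e').map_source hz
    rw [OpenPartialHomeomorph.trans_target] at this
    exact this.1
  rw [← complexHessian_comp (u := localRep φ e')
    (contDiffAt_ofReal (contDiffAt_chart hφ he' hmem)) hτ]
  have h1 : localRep φ e =ᶠ[nhds z] fun w => localRep φ e' ((e.symm.trans e') w) := by
    filter_upwards [(e.symm.trans e').open_source.mem_nhds hz] with w hw
    rw [OpenPartialHomeomorph.trans_source] at hw
    simp only [localRep, OpenPartialHomeomorph.coe_trans, Function.comp_apply]
    rw [e'.left_inv hw.2]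
  ext a b
  rw [complexHessian_apply, complexHessian_apply, wd_congr (wd_eventuallyEq h1)]

theorem mem_source_transition (e : OpenPartialHomeomorph M (Cn m)) {x : M} (hx : x ∈ e.source) :
    chartAt (Cn m) x x ∈ ((chartAt (Cn m) x).symm.trans e).source ∧
      ((chartAt (Cn m) x).symm.trans e) (chartAt (Cn m) x x) = e x := by
  simp [hx]

theorem det_jac_ne (g : KahlerMetric m M) (he : e ∈ atlas (Cn m) M)
    (he' : e' ∈ atlas (Cn m) M) {z : Cn m}
    (hz : z ∈ (e.symm.trans e').source) :
    ((jac (e.symm.trans e') z)ᵀ).det ≠ 0 ∧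
      ((jac (e.symm.trans e') z).map (starRingEnd ℂ)).det ≠ 0 := by
  have hz' := hz
  rw [OpenPartialHomeomorph.trans_source] at hz'
  have h1 := (g.posDef e he z hz'.1).det_pos.ne'
  rw [g.coeff_eq he he' hz, det_mul, det_mul] at h1
  exact ⟨left_ne_zero_of_mul (left_ne_zero_of_mul h1), right_ne_zero_of_mul h1⟩

variable [IsManifold 𝓘(ℂ, Cn m) ω M]

/-- The Laplacian computed in an arbitrary chart. -/
theorem laplacian_eq {φ : M → ℝ} (hφ : ContMDiff 𝓘(ℝ, Cn m) 𝓘(ℝ) 2 φ)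
    (he : e ∈ atlas (Cn m) M) {x : M} (hx : x ∈ e.source) :
    g.laplacian φ x = -(((g.coeff e (e x))⁻¹ * complexHessian (localRep φ e) (e x)).trace).re := by
  obtain ⟨h1, h2⟩ := mem_source_transition e hx
  have hc := chart_mem_atlas (Cn m) x
  have hd := g.det_jac_ne hc he h1
  rw [laplacian, g.coeff_eq hc he h1, complexHessian_localRep_eq hφ hc he h1,
    trace_inv_mul_congruence hd.1 hd.2, h2]

/-- The Calabi–Yau operator computed in an arbitrary chart. -/
theorem calabiYau_eq {φ : M → ℝ} (hφ : ContMDiff 𝓘(ℝ, Cn m) 𝓘(ℝ) 2 φ)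
    (he : e ∈ atlas (Cn m) M) {x : M} (hx : x ∈ e.source) :
    g.calabiYau φ x = (g.perturbed φ e (e x)).det / (g.coeff e (e x)).det := by
  obtain ⟨h1, h2⟩ := mem_source_transition e hx
  have hc := chart_mem_atlas (Cn m) x
  have hd := g.det_jac_ne hc he h1
  rw [calabiYau, perturbed, g.coeff_eq hc he h1, complexHessian_localRep_eq hφ hc he h1, h2,
    ← add_mul, ← mul_add, det_mul, det_mul, det_mul, det_mul, mul_div_mul_right _ _ hd.2,
    mul_div_mul_left _ _ hd.1]
  rfl

theorem bisect_coeff_eq (he : e ∈ atlas (Cn m) M) (he' : e' ∈ atlas (Cn m) M) {z : Cn m}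
    (hz : z ∈ (e.symm.trans e').source) (u v : Fin m → ℂ) :
    bisect (g.coeff e) z u v = bisect (g.coeff e') (e.symm.trans e' z)
      (jac (e.symm.trans e') z *ᵥ u) (jac (e.symm.trans e') z *ᵥ v) := by
  have hz' := hz
  rw [OpenPartialHomeomorph.trans_source] at hz'
  have hmem : (e.symm.trans e') z ∈ e'.target := by
    have := (e.symm.trans e').map_source hz
    rw [OpenPartialHomeomorph.trans_target] at this
    exact this.1
  have h' := g.isKahlerNear he' hmem
  refine bisect_comp (g.isKahlerNear he hz'.1).det_ne h'.contDiff h'.det_ne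
    (contDiffAt_transition he he' hz) ?_ u v
  filter_upwards [(e.symm.trans e').open_source.mem_nhds hz] with w hw using g.coeff_eq he he' hw

/-- The curvature of a Kähler metric on a compact manifold is bounded. -/
theorem exists_curvatureBoundedBy [CompactSpace M] : ∃ K : ℝ, g.CurvatureBoundedBy K := by
  have key : ∃ K : ℝ, ∀ x ∈ (Set.univ : Set M), ∀ e ∈ atlas (Cn m) M, x ∈ e.source →
      ∀ u v : Fin m → ℂ, sesq (g.coeff e (e x)) u u = 1 → sesq (g.coeff e (e x)) v v = 1 →
        ‖bisect (g.coeff e) (e x) u v‖ ≤ K := by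
    refine isCompact_univ.induction_on ⟨0, by simp⟩ ?_ ?_ ?_
    · rintro s t hst ⟨K, hK⟩
      exact ⟨K, fun x hx => hK x (hst hx)⟩
    · rintro s t ⟨K, hK⟩ ⟨K', hK'⟩
      refine ⟨max K K', ?_⟩
      rintro x (hx | hx) e he hxe u v hu hv
      · exact (hK x hx e he hxe u v hu hv).trans (le_max_left _ _)
      · exact (hK' x hx e he hxe u v hu hv).trans (le_max_right _ _)
    · intro p _
      have hp := mem_chart_source (Cn m) p
      have hc := chart_mem_atlas (Cn m) p
      set e₀ := chartAt (Cn m) p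
      obtain ⟨K, hK⟩ := exists_bisect_bound_near (g.isKahlerNear hc (e₀.map_source hp))
      have h1 := (e₀.continuousAt hp).eventually hK
      rw [nhdsWithin_univ]
      refine ⟨_, h1.and (e₀.open_source.mem_nhds hp), K, ?_⟩
      rintro x ⟨hx, hxs⟩ e he hxe u v hu hv
      change x ∈ e₀.source at hxs
      have hz : e x ∈ (e.symm.trans e₀).source := by
        simpa [hxe] using hxs
      have hv' : (e.symm.trans e₀) (e x) = e₀ x := by simp [hxe]
      rw [g.coeff_eq he hc hz, sesq_congruence, hv'] at hu hv
      rw [g.bisect_coeff_eq he hc hz, hv']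
      exact hx _ _ hu hv
  obtain ⟨K, hK⟩ := key
  refine ⟨K, fun e he z hz u v hu hv => ?_⟩
  rw [g.bisectional_eq_bisect he hz]
  have := hK (e.symm z) (Set.mem_univ _) e he (e.map_target hz) u v
  rw [e.right_inv hz] at this
  exact this hu hv

end KahlerMetric

end Charts

/-! ### The second order estimate on a compact manifold -/

namespace KahlerMetric

variable {m : ℕ} {M : Type*} [TopologicalSpace M] [ChartedSpace (Cn m) M]
  [IsManifold 𝓘(ℂ, Cn m) ω M] (g : KahlerMetric m M) {φ f : M → ℝ}

theorem sub_laplacian_eq_trace (hφ : ContMDiff 𝓘(ℝ, Cn m) 𝓘(ℝ) 2 φ)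
    {e : OpenPartialHomeomorph M (Cn m)} (he : e ∈ atlas (Cn m) M) {x : M} (hx : x ∈ e.source) :
    m - g.laplacian φ x = (((g.coeff e (e x))⁻¹ * g.perturbed φ e (e x)).trace).re := by
  have h0 := (g.isKahlerNear he (e.map_source hx)).det_ne
  rw [g.laplacian_eq hφ he hx, perturbed, mul_add, nonsing_inv_mul _ (isUnit_iff_ne_zero.2 h0),
    trace_add, trace_one, Complex.add_re]
  simp

theorem isKahlerNear_perturbed (hφ : ContMDiff 𝓘(ℝ, Cn m) 𝓘(ℝ) 4 φ) (hadm : g.Admissible φ)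
    {e : OpenPartialHomeomorph M (Cn m)} (he : e ∈ atlas (Cn m) M) {z : Cn m} (hz : z ∈ e.target) :
    IsKahlerNear (g.perturbed φ e) z := by
  refine (g.isKahlerNear he hz).add_complexHessian
    (contDiffAt_ofReal (contDiffAt_chart hφ he hz)) ?_
  filter_upwards [e.open_target.mem_nhds hz] with w hw using hadm e he w hw

theorem laplacian_lt (hm : 1 ≤ m) (hφ : ContMDiff 𝓘(ℝ, Cn m) 𝓘(ℝ) 2 φ)
    (hadm : g.Admissible φ) (x : M) : g.laplacian φ x < m := by
  have : Nonempty (Fin m) := ⟨⟨0, hm⟩⟩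
  have hc := chart_mem_atlas (Cn m) x
  have hx := mem_chart_source (Cn m) x
  have ht := (chartAt (Cn m) x).map_source hx
  have h1 := trace_inv_mul_pos (g.posDef _ hc _ ht) (hadm _ hc _ ht)
  rw [← g.sub_laplacian_eq_trace hφ hc hx] at h1
  linarith

theorem continuous_laplacian (hφ : ContMDiff 𝓘(ℝ, Cn m) 𝓘(ℝ) 4 φ) (hadm : g.Admissible φ) :
    Continuous (g.laplacian φ) := by
  rw [continuous_iff_continuousAt]
  intro p
  have hc := chart_mem_atlas (Cn m) p
  have hp := mem_chart_source (Cn m) p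
  set e := chartAt (Cn m) p
  have ht := e.map_source hp
  have hG := g.isKahlerNear hc ht
  have h1 : ContinuousAt (fun w => (((g.coeff e w)⁻¹ * g.perturbed φ e w).trace).re) (e p) :=
    Complex.continuous_re.continuousAt.comp ((hG.contDiff.inv hG.det_ne).mul
      (g.isKahlerNear_perturbed hφ hadm hc ht).contDiff).trace.continuousAt
  have h2 : ContinuousAt
      (fun x => m - (((g.coeff e (e x))⁻¹ * g.perturbed φ e (e x)).trace).re) p :=
    continuousAt_const.sub (h1.comp (e.continuousAt hp))
  refine h2.congr ?_
  filter_upwards [e.open_source.mem_nhds hp] with x hx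
  rw [← g.sub_laplacian_eq_trace (hφ.of_le (by norm_num)) hc hx]
  ring

/-- The second order estimate: the maximum principle is applied to
`(m - Δφ) e^{-cφ} = tr(g⁻¹g̃) e^{-cφ}` at a point where this function is maximal. -/
theorem sub_laplacian_le [CompactSpace M] {K F₀ F₁ : ℝ} (hm : 1 ≤ m)
    (hK : g.CurvatureBoundedBy K) (hφ : ContMDiff 𝓘(ℝ, Cn m) 𝓘(ℝ) 4 φ)
    (hf : ContMDiff 𝓘(ℝ, Cn m) 𝓘(ℝ) 2 f) (hadm : g.Admissible φ)
    (heq : ∀ x, g.calabiYau φ x = ((Real.exp (f x) : ℝ) : ℂ)) (hF₀ : ∀ x, f x ≤ F₀)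
    (hF₁ : ∀ x, g.laplacian f x ≤ F₁) (x : M) :
    m - g.laplacian φ x ≤ max 1 (m * (Real.exp F₀ * (|F₁| + (2 * |K| + 1) * m) ^ (m - 1)))
      * Real.exp ((2 * |K| + 1) * ((⨆ y, φ y) - ⨅ y, φ y)) := by
  set c : ℝ := 2 * |K| + 1 with hc
  have hφ2 : ContMDiff 𝓘(ℝ, Cn m) 𝓘(ℝ) 2 φ := hφ.of_le (by norm_num)
  have hcont : Continuous fun y => (m - g.laplacian φ y) * Real.exp (-c * φ y) :=
    (continuous_const.sub (g.continuous_laplacian hφ hadm)).mul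
      (Real.continuous_exp.comp (continuous_const.mul hφ.continuous))
  obtain ⟨p, -, hp⟩ := isCompact_univ.exists_isMaxOn ⟨x, Set.mem_univ x⟩ hcont.continuousOn
  have hmaxp : ∀ y, (m - g.laplacian φ y) * Real.exp (-c * φ y)
      ≤ (m - g.laplacian φ p) * Real.exp (-c * φ p) := fun y => hp (Set.mem_univ y)
  have hat := chart_mem_atlas (Cn m) p
  have hps := mem_chart_source (Cn m) p
  set e := chartAt (Cn m) p with he
  have ht := e.map_source hps
  have hnear := e.open_target.mem_nhds ht
  have hmax : IsLocalMax (fun w => ((g.coeff e w)⁻¹ * (g.coeff e w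
      + complexHessian (fun y => ((φ (e.symm y) : ℝ) : ℂ)) w)).trace.re
      * Real.exp (-c * φ (e.symm w))) (e p) := by
    have hval : ∀ w ∈ e.target, ((g.coeff e w)⁻¹ * (g.coeff e w
        + complexHessian (fun y => ((φ (e.symm y) : ℝ) : ℂ)) w)).trace.re
        * Real.exp (-c * φ (e.symm w))
        = (m - g.laplacian φ (e.symm w)) * Real.exp (-c * φ (e.symm w)) := fun w hw => by
      rw [g.sub_laplacian_eq_trace hφ2 hat (e.map_target hw), e.right_inv hw]
      rfl
    filter_upwards [hnear] with w hw
    rw [hval w hw, hval _ ht, e.left_inv hps]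
    exact hmaxp _
  have hdet : ∀ᶠ w in nhds (e p), (g.coeff e w
      + complexHessian (fun y => ((φ (e.symm y) : ℝ) : ℂ)) w).det
      = Complex.exp (f (e.symm w)) * (g.coeff e w).det := by
    filter_upwards [hnear] with w hw
    have h1 := heq (e.symm w)
    rw [g.calabiYau_eq hφ2 hat (e.map_target hw), e.right_inv hw,
      div_eq_iff (g.isKahlerNear hat hw).det_ne, Complex.ofReal_exp] at h1
    exact h1
  have hlap := hF₁ p
  rw [g.laplacian_eq hf hat hps] at hlap
  have hbound := trace_le_of_isLocalMax (φ := fun w => φ (e.symm w)) (f := fun w => f (e.symm w))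
    (K := K) (F₀ := F₀) (F₁ := F₁) hm (g.isKahlerNear hat ht)
    (g.isKahlerNear_perturbed hφ hadm hat ht) (contDiffAt_chart hφ2 hat ht)
    (contDiffAt_chart hf hat ht) hdet
    (fun u v hu hv => by
      rw [← g.bisectional_eq_bisect hat ht]
      exact hK e hat _ ht u v hu hv)
    (hF₀ _) hlap hmax
  have hSp : m - g.laplacian φ p ≤ max 1 (m * (Real.exp F₀ * (|F₁| + c * m) ^ (m - 1))) := by
    rw [g.sub_laplacian_eq_trace hφ2 hat hps]
    exact hbound
  set C := max 1 (m * (Real.exp F₀ * (|F₁| + c * m) ^ (m - 1)))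
  have hC : 0 < C := zero_lt_one.trans_le (le_max_left _ _)
  have hbdd := isCompact_range hφ.continuous
  have h1 : φ x ≤ ⨆ y, φ y := le_ciSup hbdd.bddAbove x
  have h2 : ⨅ y, φ y ≤ φ p := ciInf_le hbdd.bddBelow p
  have hc0 : 0 ≤ c := by positivity
  calc m - g.laplacian φ x
      = (m - g.laplacian φ x) * Real.exp (-c * φ x) * Real.exp (c * φ x) := by
        rw [mul_assoc, ← Real.exp_add]; simp
    _ ≤ (m - g.laplacian φ p) * Real.exp (-c * φ p) * Real.exp (c * φ x) :=
        mul_le_mul_of_nonneg_right (hmaxp x) (Real.exp_pos _).le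
    _ ≤ C * Real.exp (-c * φ p) * Real.exp (c * φ x) := by gcongr
    _ = C * Real.exp (c * (φ x - φ p)) := by
        rw [mul_assoc, ← Real.exp_add]; congr 2; ring
    _ ≤ _ := by
        refine mul_le_mul_of_nonneg_left (Real.exp_le_exp.2 ?_) hC.le
        exact mul_le_mul_of_nonneg_left (by linarith) hc0

end KahlerMetric

end KahlerGeometry

theorem mainTheorem7 :
    ∃ (c : ℝ → ℝ) (C₁ : ℕ → ℝ → ℝ → ℝ → ℝ),
      (∀ K : ℝ, 0 < c K) ∧
      (∀ (m : ℕ) (F₀ F₁ K : ℝ), 0 < C₁ m F₀ F₁ K) ∧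
      ∀ (m : ℕ) (_ : 1 ≤ m)
        (M : Type*) [TopologicalSpace M] [T2Space M] [CompactSpace M]
        [ChartedSpace (KahlerGeometry.Cn m) M]
        [IsManifold 𝓘(ℂ, KahlerGeometry.Cn m) ω M]
        (g : KahlerGeometry.KahlerMetric m M),
        (∃ K : ℝ, g.CurvatureBoundedBy K) ∧
        ∀ (K : ℝ) (_ : g.CurvatureBoundedBy K) (F₀ F₁ : ℝ) (φ f : M → ℝ)
          (_ : ContMDiff 𝓘(ℝ, KahlerGeometry.Cn m) 𝓘(ℝ) 5 φ)
          (_ : ContMDiff 𝓘(ℝ, KahlerGeometry.Cn m) 𝓘(ℝ) 3 f)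
          (_ : g.Admissible φ)
          (_ : ∀ x : M, g.calabiYau φ x = ((Real.exp (f x) : ℝ) : ℂ))
          (_ : ∀ x : M, f x ≤ F₀)
          (_ : ∀ x : M, g.laplacian f x ≤ F₁),
          ∀ x : M,
            m - C₁ m F₀ F₁ K * Real.exp (c K * ((⨆ y, φ y) - ⨅ y, φ y)) ≤ g.laplacian φ x ∧
            g.laplacian φ x < m := by
  refine ⟨fun K => 2 * |K| + 1, fun m F₀ F₁ K =>
    max 1 (m * (Real.exp F₀ * (|F₁| + (2 * |K| + 1) * m) ^ (m - 1))), fun K => by positivity,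
    fun m F₀ F₁ K => zero_lt_one.trans_le (le_max_left _ _), ?_⟩
  intro m hm M _ _ _ _ _ g
  refine ⟨g.exists_curvatureBoundedBy, fun K hK F₀ F₁ φ f hφ hf hadm heq hF₀ hF₁ x => ⟨?_, ?_⟩⟩
  · have := g.sub_laplacian_le hm hK (hφ.of_le (by norm_num)) (hf.of_le (by norm_num)) hadm heq
      hF₀ hF₁ x
    linarith
  · exact g.laplacian_lt hm (hφ.of_le (by norm_num)) hadm x
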